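/- Let $n\ge 0$ and let $R=\mathbb{C}\{x_1,\dots,x_n\}$ be the ring of convergent complex power series in $n$ variables, with maximal ideal $\mathcal{M}=\{h\in R : h(0)=0\}$. For $f\in R$ let $J_f=(\partial f/\partial x_1,\dots,\partial f/\partial x_n)\subset R$ be the Jacobian ideal and $\mu(f)=\dim_{\mathbb{C}} R/J_f$ the Milnor number. If $\mu(f)<\infty$, then for every $g\in\mathcal{M}^{\mu(f)+2}$ there exists a $\mathbb{C}$-algebra automorphism $\varphi$ of $R$ such that $\varphi(f+g)=f$. -/

import Mathlib

/-- A complex power series in `n` variables converges if it converges absolutely on some closed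
polydisc of positive radius about the origin. -/
def MvPowerSeries.IsConvergent {n : ℕ} (f : MvPowerSeries (Fin n) ℂ) : Prop :=
  ∃ r : ℝ, 0 < r ∧ Summable fun d : Fin n →₀ ℕ => ‖MvPowerSeries.coeff d f‖ * r ^ d.degree

theorem MvPowerSeries.summable_of_le {n : ℕ} {f : MvPowerSeries (Fin n) ℂ} {r s : ℝ}
    (hs : 0 ≤ s) (hsr : s ≤ r)
    (h : Summable fun d : Fin n →₀ ℕ => ‖MvPowerSeries.coeff d f‖ * r ^ d.degree) :
    Summable fun d : Fin n →₀ ℕ => ‖MvPowerSeries.coeff d f‖ * s ^ d.degree :=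
  h.of_nonneg_of_le (fun d => by positivity) (fun d => by gcongr)

theorem MvPowerSeries.IsConvergent.add {n : ℕ} {f g : MvPowerSeries (Fin n) ℂ}
    (hf : f.IsConvergent) (hg : g.IsConvergent) : (f + g).IsConvergent := by
  obtain ⟨r, hr, hf⟩ := hf
  obtain ⟨s, hs, hg⟩ := hg
  have ht : 0 < min r s := lt_min hr hs
  refine ⟨min r s, ht, ?_⟩
  refine ((summable_of_le ht.le (min_le_left r s) hf).add
    (summable_of_le ht.le (min_le_right r s) hg)).of_nonneg_of_le
    (fun d => by positivity) (fun d => ?_)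
  rw [map_add, ← add_mul]
  gcongr
  exact norm_add_le _ _

theorem MvPowerSeries.IsConvergent.mul {n : ℕ} {f g : MvPowerSeries (Fin n) ℂ}
    (hf : f.IsConvergent) (hg : g.IsConvergent) : (f * g).IsConvergent := by
  obtain ⟨r, hr, hf⟩ := hf
  obtain ⟨s, hs, hg⟩ := hg
  have ht : 0 < min r s := lt_min hr hs
  refine ⟨min r s, ht, ?_⟩
  let F : (Fin n →₀ ℕ) → ℝ := fun d => ‖MvPowerSeries.coeff d f‖ * min r s ^ d.degree
  let G : (Fin n →₀ ℕ) → ℝ := fun d => ‖MvPowerSeries.coeff d g‖ * min r s ^ d.degree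
  have hF : Summable F := summable_of_le ht.le (min_le_left r s) hf
  have hG : Summable G := summable_of_le ht.le (min_le_right r s) hg
  have hFG : Summable fun x : (Fin n →₀ ℕ) × (Fin n →₀ ℕ) => F x.1 * G x.2 :=
    hF.mul_of_nonneg hG (fun d => by positivity) (fun d => by positivity)
  have h : Summable fun d : Fin n →₀ ℕ => ∑ p ∈ Finset.HasAntidiagonal.antidiagonal d, F p.1 * G p.2 :=
    summable_sum_mul_antidiagonal_of_summable_mul hFG
  refine h.of_nonneg_of_le (fun d => by positivity) (fun d => ?_)
  rw [MvPowerSeries.coeff_mul]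
  calc _ ≤ (∑ p ∈ Finset.HasAntidiagonal.antidiagonal d, ‖coeff p.1 f * coeff p.2 g‖) *
        min r s ^ d.degree := by
        gcongr
        exact norm_sum_le _ _
    _ = ∑ p ∈ Finset.HasAntidiagonal.antidiagonal d, F p.1 * G p.2 := by
        rw [Finset.sum_mul]
        refine Finset.sum_congr rfl fun p hp => ?_
        have hd : d.degree = p.1.degree + p.2.degree := by
          rw [← Finset.HasAntidiagonal.mem_antidiagonal.mp hp, map_add]
        rw [hd, pow_add, norm_mul]
        exact mul_mul_mul_comm _ _ _ _

theorem MvPowerSeries.isConvergent_C {n : ℕ} (c : ℂ) :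
    (MvPowerSeries.C c : MvPowerSeries (Fin n) ℂ).IsConvergent := by
  classical
  refine ⟨1, one_pos, summable_of_ne_finset_zero (s := {0}) fun d hd => ?_⟩
  rw [MvPowerSeries.coeff_C, if_neg (by simpa using hd)]
  simp

theorem MvPowerSeries.IsConvergent.pderiv {n : ℕ} {f : MvPowerSeries (Fin n) ℂ}
    (hf : f.IsConvergent) (i : Fin n) : (MvPowerSeries.pderiv ℂ i f).IsConvergent := by
  obtain ⟨r, hr, hf⟩ := hf
  refine ⟨r / 2, by positivity, ?_⟩
  have h := (hf.comp_injective
    (add_left_injective (Finsupp.single i 1 : Fin n →₀ ℕ))).mul_left r⁻¹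
  refine h.of_nonneg_of_le (fun d => by positivity) (fun d => ?_)
  have h1 : ‖((d i : ℂ) + 1)‖ ≤ 2 ^ d.degree := by
    have h2 : d i + 1 ≤ 2 ^ d.degree :=
      (Nat.lt_two_pow_self).trans_le (Nat.pow_le_pow_right two_pos (Finsupp.le_degree i d))
    have h3 : ((d i : ℂ) + 1) = ((d i + 1 : ℕ) : ℂ) := by push_cast; ring
    rw [h3, Complex.norm_natCast]
    exact_mod_cast h2
  have h4 : (d + Finsupp.single i 1).degree = d.degree + 1 := by simp
  rw [MvPowerSeries.coeff_pderiv, norm_mul, Function.comp_apply, h4, div_pow]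
  calc _ ≤ ‖coeff (d + Finsupp.single i 1) f‖ * 2 ^ d.degree *
        (r ^ d.degree / 2 ^ d.degree) := by gcongr
    _ = _ := by
        rw [pow_succ]
        field_simp

/-- The `ℂ`-algebra `ℂ{x₁, …, xₙ}` of convergent power series. -/
def ConvergentSeries (n : ℕ) : Subalgebra ℂ (MvPowerSeries (Fin n) ℂ) where
  carrier := {f | f.IsConvergent}
  mul_mem' := MvPowerSeries.IsConvergent.mul
  add_mem' := MvPowerSeries.IsConvergent.add
  algebraMap_mem' := MvPowerSeries.isConvergent_C

namespace ConvergentSeries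

/-- The maximal ideal `{f | f(0) = 0}` of `ℂ{x₁, …, xₙ}`. -/
noncomputable def maximalIdeal (n : ℕ) : Ideal (ConvergentSeries n) :=
  RingHom.ker ((MvPowerSeries.constantCoeff (σ := Fin n) (R := ℂ)).comp
    (ConvergentSeries n).val.toRingHom)

/-- The partial derivative `∂f/∂xᵢ` of a convergent power series. -/
noncomputable def pderiv {n : ℕ} (i : Fin n) (f : ConvergentSeries n) : ConvergentSeries n :=
  ⟨MvPowerSeries.pderiv ℂ i f.1, MvPowerSeries.IsConvergent.pderiv f.2 i⟩

/-- The Jacobian ideal `(∂f/∂x₁, …, ∂f/∂xₙ)` in `ℂ{x₁, …, xₙ}`. -/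
noncomputable def jacobianIdeal {n : ℕ} (f : ConvergentSeries n) : Ideal (ConvergentSeries n) :=
  Ideal.span (Set.range fun i => pderiv i f)

/-- The Milnor number, the complex dimension of `ℂ{x₁, …, xₙ} / J_f` (possibly infinite). -/
noncomputable def milnorNumber {n : ℕ} (f : ConvergentSeries n) : ℕ∞ :=
  Cardinal.toENat (Module.rank ℂ (ConvergentSeries n ⧸ jacobianIdeal f))

end ConvergentSeries

/-!
The automorphism is the time-one flow of a time-dependent vector field `ξ`, chosen such that the
flow carries the path `f + t g` to the constant path `f`.

The algebraic input is that every monomial of degree `μ = μ(f)` lies in the Jacobian ideal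
(`ConvergentSeries.exists_vectorField_eq_monomial`): in a quotient of dimension `μ` the `μ + 1`
partial products of `μ` elements of the maximal ideal are linearly dependent, and the first partial
product occurring in a relation divides it with a unit as quotient. Hence a series `h` of order at
least `μ + p` is of the form `(L h) f` for a vector field `L h` whose coefficients have order at
least `p`, with explicit bounds (`ConvergentSeries.exists_vectorField_eq`).

The infinitesimal equation `ξ (f + t g) = - g` is solved by `ξ = L h`, where `h + t (L h) g = - g`.
Since `g` has order at least `μ + 2`, the operator `h ↦ (L h) g` raises orders and has small norm on
small polydiscs, so `h`, and with it `ξ`, is given by a Neumann series in `t` that converges for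
`|t| ≤ 1` (`ConvergentSeries.exists_time_dependent_vectorField`).

The flow is constructed algebraically, as the time-ordered exponential `Φ' = Φ ξ` in formal power
series in `t` with linear operators as coefficients (`timeOrderedExp`). It is invertible,
multiplicative because `ξ` is a derivation, and constant on `f + t g` because
`Φ (ξ (f + t g)) + Φ g = 0`. The coefficient of `t ^ k` raises orders by `k`, so that setting `t = 1`
makes sense for formal series. Cauchy estimates on nested polydiscs, in which the loss of radius is
distributed evenly over the `k` derivatives, show that the flow and its inverse preserve convergence
(`MvPowerSeries.cauchyBounded_of_recursion`); this uses that the coefficients of `ξ` vanish to order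
two at the origin, which makes the flow exist up to time one on all small polydiscs.
-/

open Finset
open scoped ENNReal NNReal

/-! ### Weighted norms of power series -/


namespace MvPowerSeries

variable {n : ℕ}

/-- The weighted `ℓ¹`-norm `∑ |F_d| r ^ |d|` of a formal power series on the polydisc of radius
`r`, with value `∞` when the series does not converge absolutely there. -/
noncomputable def polydiscNorm (r : ℝ≥0) (F : MvPowerSeries (Fin n) ℂ) : ℝ≥0∞ :=
  ∑' d : Fin n →₀ ℕ, ‖coeff d F‖ₑ * (r : ℝ≥0∞) ^ d.degree

theorem isConvergent_iff_polydiscNorm_ne_top {F : MvPowerSeries (Fin n) ℂ} :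
    F.IsConvergent ↔ ∃ r : ℝ≥0, 0 < r ∧ polydiscNorm r F ≠ ∞ := by
  have key : ∀ r : ℝ≥0, polydiscNorm r F ≠ ∞ ↔
      Summable fun d : Fin n →₀ ℕ => ‖coeff d F‖ * (r : ℝ) ^ d.degree := by
    intro r
    have h : polydiscNorm r F
        = ∑' d : Fin n →₀ ℕ, ((‖coeff d F‖₊ * r ^ d.degree : ℝ≥0) : ℝ≥0∞) := by
      refine tsum_congr fun d => ?_
      push_cast
      rfl
    rw [h, ENNReal.tsum_coe_ne_top_iff_summable, ← NNReal.summable_coe]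
    simp
  constructor
  · rintro ⟨r, hr, h⟩
    exact ⟨⟨r, hr.le⟩, hr, (key _).2 h⟩
  · rintro ⟨r, hr, h⟩
    exact ⟨r, hr, (key r).1 h⟩

theorem polydiscNorm_mono {r s : ℝ≥0} (h : r ≤ s) (F : MvPowerSeries (Fin n) ℂ) :
    polydiscNorm r F ≤ polydiscNorm s F :=
  ENNReal.tsum_le_tsum fun d => by gcongr

theorem polydiscNorm_add_le (r : ℝ≥0) (F G : MvPowerSeries (Fin n) ℂ) :
    polydiscNorm r (F + G) ≤ polydiscNorm r F + polydiscNorm r G := by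
  rw [polydiscNorm, polydiscNorm, polydiscNorm, ← ENNReal.tsum_add]
  refine ENNReal.tsum_le_tsum fun d => ?_
  rw [map_add, ← add_mul]
  gcongr
  exact enorm_add_le _ _

@[simp]
theorem polydiscNorm_zero (r : ℝ≥0) : polydiscNorm r (0 : MvPowerSeries (Fin n) ℂ) = 0 := by
  simp [polydiscNorm]

@[simp]
theorem polydiscNorm_neg (r : ℝ≥0) (F : MvPowerSeries (Fin n) ℂ) :
    polydiscNorm r (-F) = polydiscNorm r F := by
  simp [polydiscNorm]

theorem polydiscNorm_sum_le {ι : Type*} (r : ℝ≥0) (s : Finset ι)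
    (F : ι → MvPowerSeries (Fin n) ℂ) :
    polydiscNorm r (∑ i ∈ s, F i) ≤ ∑ i ∈ s, polydiscNorm r (F i) := by
  classical
  induction s using Finset.induction_on with
  | empty => simp
  | insert a s ha ih =>
    rw [sum_insert ha, sum_insert ha]
    exact (polydiscNorm_add_le _ _ _).trans (by gcongr)

theorem polydiscNorm_smul (r : ℝ≥0) (c : ℂ) (F : MvPowerSeries (Fin n) ℂ) :
    polydiscNorm r (c • F) = ‖c‖ₑ * polydiscNorm r F := by
  rw [polydiscNorm, polydiscNorm, ← ENNReal.tsum_mul_left]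
  refine tsum_congr fun d => ?_
  rw [map_smul, smul_eq_mul, enorm_mul, mul_assoc]

theorem polydiscNorm_one_le (r : ℝ≥0) :
    polydiscNorm r (1 : MvPowerSeries (Fin n) ℂ) ≤ 1 := by
  classical
  rw [polydiscNorm, tsum_eq_single 0]
  · simp
  · intro d hd
    simp [coeff_one, hd]

theorem polydiscNorm_mul_le (r : ℝ≥0) (F G : MvPowerSeries (Fin n) ℂ) :
    polydiscNorm r (F * G) ≤ polydiscNorm r F * polydiscNorm r G := by
  classical
  let A : (Fin n →₀ ℕ) → ℝ≥0∞ := fun d => ‖coeff d F‖ₑ * (r : ℝ≥0∞) ^ d.degree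
  let B : (Fin n →₀ ℕ) → ℝ≥0∞ := fun d => ‖coeff d G‖ₑ * (r : ℝ≥0∞) ^ d.degree
  calc polydiscNorm r (F * G)
      ≤ ∑' d : Fin n →₀ ℕ, ∑ p ∈ antidiagonal d, A p.1 * B p.2 := by
        refine ENNReal.tsum_le_tsum fun d => ?_
        rw [coeff_mul]
        calc _ ≤ (∑ p ∈ antidiagonal d, ‖coeff p.1 F * coeff p.2 G‖ₑ) * (r : ℝ≥0∞) ^ d.degree := by
              gcongr
              exact enorm_sum_le _ _
          _ = _ := by
              rw [sum_mul]
              refine sum_congr rfl fun p hp => ?_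
              rw [← mem_antidiagonal.mp hp, map_add, pow_add, enorm_mul]
              exact mul_mul_mul_comm _ _ _ _
    _ = ∑' d : Fin n →₀ ℕ, ∑' p : antidiagonal d, A p.1.1 * B p.1.2 := by
        refine tsum_congr fun d => ?_
        rw [tsum_fintype, ← sum_coe_sort (antidiagonal d) fun p => A p.1 * B p.2]
    _ = ∑' p : (Fin n →₀ ℕ) × (Fin n →₀ ℕ), A p.1 * B p.2 := by
        exact (ENNReal.tsum_sigma' fun x : (d : Fin n →₀ ℕ) × antidiagonal d =>
          A x.2.1.1 * B x.2.1.2).symm.trans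
            (HasAntidiagonal.sigmaAntidiagonalEquivProd.tsum_eq fun p => A p.1 * B p.2)
    _ = polydiscNorm r F * polydiscNorm r G := by
        rw [ENNReal.tsum_prod', polydiscNorm, polydiscNorm, ← ENNReal.tsum_mul_right]
        exact tsum_congr fun d =>
          (ENNReal.tsum_mul_left : ∑' e, A d * B e = A d * ∑' e, B e)

/-- Schwarz lemma: a series of order at least `p` has norm `O(r ^ p)` on small polydiscs. -/
theorem polydiscNorm_le_of_le_order {F : MvPowerSeries (Fin n) ℂ} {p : ℕ} (hF : p ≤ F.order)
    {r s : ℝ≥0} (hrs : r ≤ s) :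
    (s : ℝ≥0∞) ^ p * polydiscNorm r F ≤ (r : ℝ≥0∞) ^ p * polydiscNorm s F := by
  rw [polydiscNorm, polydiscNorm, ← ENNReal.tsum_mul_left, ← ENNReal.tsum_mul_left]
  refine ENNReal.tsum_le_tsum fun d => ?_
  rcases lt_or_ge d.degree p with h | h
  · rw [coeff_of_lt_order (lt_of_lt_of_le (by exact_mod_cast h) hF)]
    simp
  · obtain ⟨m, hm⟩ := Nat.exists_eq_add_of_le h
    rw [hm, pow_add, pow_add]
    calc _ = ‖coeff d F‖ₑ * ((s : ℝ≥0∞) ^ p * (r : ℝ≥0∞) ^ p) * (r : ℝ≥0∞) ^ m := by ring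
      _ ≤ ‖coeff d F‖ₑ * ((s : ℝ≥0∞) ^ p * (r : ℝ≥0∞) ^ p) * (s : ℝ≥0∞) ^ m := by gcongr
      _ = _ := by ring

/-- Cauchy estimate: differentiation is bounded at the price of shrinking the polydisc. -/
theorem mul_polydiscNorm_pderiv_le (r δ : ℝ≥0) (i : Fin n) (F : MvPowerSeries (Fin n) ℂ) :
    δ * polydiscNorm r (pderiv ℂ i F) ≤ polydiscNorm (r + δ) F := by
  rw [polydiscNorm, ← ENNReal.tsum_mul_left]
  refine le_trans ?_ (ENNReal.tsum_comp_le_tsum_of_injective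
    (add_left_injective (Finsupp.single i 1 : Fin n →₀ ℕ)) _)
  refine ENNReal.tsum_le_tsum fun d => ?_
  have hdeg : (d + Finsupp.single i 1).degree = d.degree + 1 := by simp
  have hd : ‖((d i : ℂ) + 1)‖ₑ ≤ ((d.degree + 1 : ℕ) : ℝ≥0∞) := by
    have h3 : ((d i : ℂ) + 1) = ((d i + 1 : ℕ) : ℂ) := by push_cast; ring
    have h4 : ‖((d i + 1 : ℕ) : ℂ)‖ₑ = ((d i + 1 : ℕ) : ℝ≥0∞) := by
      rw [← ofReal_norm, Complex.norm_natCast, ENNReal.ofReal_natCast]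
    rw [h3, h4]
    exact_mod_cast Nat.succ_le_succ (Finsupp.le_degree i d)
  have hb : ∀ m : ℕ, δ * ((m + 1 : ℕ) : ℝ≥0) * r ^ m ≤ (r + δ) ^ (m + 1) := by
    intro m
    induction m with
    | zero => simp
    | succ m ih =>
      calc δ * ((m + 1 + 1 : ℕ) : ℝ≥0) * r ^ (m + 1)
          = (δ * ((m + 1 : ℕ) : ℝ≥0) * r ^ m) * r + r ^ (m + 1) * δ := by push_cast; ring
        _ ≤ (r + δ) ^ (m + 1) * r + (r + δ) ^ (m + 1) * δ := by
            gcongr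
            exact le_self_add
        _ = _ := by ring
  rw [coeff_pderiv, enorm_mul, hdeg]
  calc _ ≤ (δ : ℝ≥0∞) * (‖coeff (d + Finsupp.single i 1) F‖ₑ * ((d.degree + 1 : ℕ) : ℝ≥0∞)
        * (r : ℝ≥0∞) ^ d.degree) := by gcongr
    _ = ‖coeff (d + Finsupp.single i 1) F‖ₑ *
        ((δ * ((d.degree + 1 : ℕ) : ℝ≥0) * r ^ d.degree : ℝ≥0) : ℝ≥0∞) := by push_cast; ring
    _ ≤ ‖coeff (d + Finsupp.single i 1) F‖ₑ * (((r + δ) ^ (d.degree + 1) : ℝ≥0) : ℝ≥0∞) := by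
        gcongr
        exact hb _
    _ = _ := by push_cast; rfl

/-! ### Series of power series of growing order -/

/-- The sum `∑ k, G k` of power series, computed in degree `d` from the terms with `k ≤ d`. It is
the sum of the series in the adic topology when `G k` has order at least `k`. -/
noncomputable def adicSum (G : ℕ → MvPowerSeries (Fin n) ℂ) : MvPowerSeries (Fin n) ℂ :=
  fun d => ∑ k ∈ range (d.degree + 1), coeff d (G k)

theorem coeff_adicSum {G : ℕ → MvPowerSeries (Fin n) ℂ} (hG : ∀ k, k ≤ (G k).order)
    {d : Fin n →₀ ℕ} {N : ℕ} (hN : d.degree < N) :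
    coeff d (adicSum G) = coeff d (∑ k ∈ range N, G k) := by
  rw [map_sum]
  change ∑ k ∈ range (d.degree + 1), coeff d (G k) = _
  refine sum_subset (range_mono hN) fun k _ hk => coeff_of_lt_order (lt_of_lt_of_le ?_ (hG k))
  rw [mem_range, not_lt] at hk
  exact_mod_cast hk

theorem le_order_add {F G : MvPowerSeries (Fin n) ℂ} {p : ℕ∞} (hF : p ≤ F.order)
    (hG : p ≤ G.order) : p ≤ (F + G).order :=
  (le_min hF hG).trans min_order_le_add

theorem le_order_sum {ι : Type*} {s : Finset ι} {G : ι → MvPowerSeries (Fin n) ℂ} {p : ℕ∞}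
    (h : ∀ i ∈ s, p ≤ (G i).order) : p ≤ (∑ i ∈ s, G i).order :=
  le_order fun d hd => by
    rw [map_sum]
    exact sum_eq_zero fun i hi => coeff_of_lt_order (hd.trans_le (h i hi))

theorem le_order_adicSum_sub {G : ℕ → MvPowerSeries (Fin n) ℂ} (hG : ∀ k, k ≤ (G k).order)
    (N : ℕ) : N ≤ (adicSum G - ∑ k ∈ range N, G k).order :=
  le_order fun d hd => by
    rw [map_sub, coeff_adicSum hG (N := N) (by exact_mod_cast hd), sub_self]

theorem polydiscNorm_adicSum_le (r : ℝ≥0) {G : ℕ → MvPowerSeries (Fin n) ℂ}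
    (hG : ∀ k, k ≤ (G k).order) : polydiscNorm r (adicSum G) ≤ ∑' k, polydiscNorm r (G k) := by
  rw [polydiscNorm, ENNReal.tsum_eq_iSup_sum]
  refine iSup_le fun s => ?_
  have hN : ∀ d ∈ s, d.degree < s.sup Finsupp.degree + 1 := fun d hd =>
    Nat.lt_succ_of_le (le_sup (f := Finsupp.degree) hd)
  calc _ = ∑ d ∈ s, ‖coeff d (∑ k ∈ range (s.sup Finsupp.degree + 1), G k)‖ₑ *
        (r : ℝ≥0∞) ^ d.degree := sum_congr rfl fun d hd => by rw [coeff_adicSum hG (hN d hd)]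
    _ ≤ polydiscNorm r (∑ k ∈ range (s.sup Finsupp.degree + 1), G k) := ENNReal.sum_le_tsum s
    _ ≤ _ := (polydiscNorm_sum_le _ _ _).trans (ENNReal.sum_le_tsum _)

/-- A double sum over a square may be computed along antidiagonals if the terms beyond the
diagonal of the square vanish. -/
theorem sum_range_sum_antidiagonal {M : Type*} [AddCommMonoid M] (u : ℕ → ℕ → M) {N : ℕ}
    (hu : ∀ i j, N ≤ i + j → u i j = 0) :
    ∑ m ∈ range N, ∑ p ∈ antidiagonal m, u p.1 p.2
      = ∑ i ∈ range N, ∑ j ∈ range N, u i j := by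
  have h : ∀ m ∈ range N, ∑ p ∈ antidiagonal m, u p.1 p.2
      = ∑ p ∈ range N ×ˢ range N with p.1 + p.2 = m, u p.1 p.2 := by
    intro m hm
    refine sum_congr ?_ fun _ _ => rfl
    ext p
    simp only [HasAntidiagonal.mem_antidiagonal, mem_filter, mem_product, mem_range] at hm ⊢
    omega
  rw [sum_congr rfl h, ← sum_product']
  have h2 : ∑ p ∈ range N ×ˢ range N with p.1 + p.2 < N, u p.1 p.2
      = ∑ p ∈ range N ×ˢ range N, u p.1 p.2 := by
    refine sum_subset (filter_subset _ _) fun p hp hp' => hu _ _ ?_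
    rw [mem_filter, not_and] at hp'
    exact not_lt.1 (hp' hp)
  rw [← h2, ← sum_fiberwise_of_maps_to (s := {p ∈ range N ×ˢ range N | p.1 + p.2 < N})
    (t := range N) (g := fun p => p.1 + p.2) (fun p hp => by simpa using (mem_filter.1 hp).2)]
  refine sum_congr rfl fun m hm => sum_congr ?_ fun _ _ => rfl
  ext p
  simp only [mem_filter, mem_product, mem_range] at hm ⊢
  omega

theorem adicSum_mul {G H : ℕ → MvPowerSeries (Fin n) ℂ} (hG : ∀ k, k ≤ (G k).order)
    (hH : ∀ k, k ≤ (H k).order) :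
    adicSum G * adicSum H = adicSum fun k => ∑ p ∈ antidiagonal k, G p.1 * H p.2 := by
  have hGH : ∀ i j : ℕ, ((i + j : ℕ) : ℕ∞) ≤ (G i * H j).order := fun i j => by
    push_cast
    exact (add_le_add (hG i) (hH j)).trans le_order_mul
  ext d
  have hsum : ∀ k, k ≤ (∑ p ∈ antidiagonal k, G p.1 * H p.2).order := fun k =>
    le_order_sum fun p hp => by
      rw [← mem_antidiagonal.1 hp]
      exact hGH _ _
  rw [coeff_adicSum hsum (Nat.lt_succ_self _), map_sum]
  simp_rw [map_sum]
  rw [sum_range_sum_antidiagonal (fun i j => coeff d (G i * H j)) fun i j hij =>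
    coeff_of_lt_order (lt_of_lt_of_le (by exact_mod_cast hij) (hGH i j))]
  simp_rw [← map_sum, ← mul_sum, ← sum_mul, coeff_mul]
  refine sum_congr rfl fun p hp => ?_
  have hdeg : p.1.degree + p.2.degree = d.degree := by rw [← map_add, mem_antidiagonal.1 hp]
  rw [coeff_adicSum hG (N := d.degree.succ) (by omega),
    coeff_adicSum hH (N := d.degree.succ) (by omega)]

/-! ### Families of operators of growing degree -/

/-- A linear operator has degree at least `k` if it raises orders by at least `k`. -/
def RaisesOrder (k : ℕ) (T : Module.End ℂ (MvPowerSeries (Fin n) ℂ)) : Prop :=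
  ∀ (p : ℕ) (F : MvPowerSeries (Fin n) ℂ), p ≤ F.order → ((p + k : ℕ) : ℕ∞) ≤ (T F).order

theorem RaisesOrder.le_order {k : ℕ} {T : Module.End ℂ (MvPowerSeries (Fin n) ℂ)}
    (hT : RaisesOrder k T) (F : MvPowerSeries (Fin n) ℂ) : k ≤ (T F).order := by
  simpa using hT 0 F (by simp)

theorem RaisesOrder.mul {k l : ℕ} {T U : Module.End ℂ (MvPowerSeries (Fin n) ℂ)}
    (hT : RaisesOrder k T) (hU : RaisesOrder l U) : RaisesOrder (k + l) (T * U) :=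
  fun p F hF => by
    have := hT _ _ (hU p F hF)
    rwa [add_assoc, add_comm l k] at this

theorem RaisesOrder.sum {ι : Type*} {s : Finset ι} {k : ℕ}
    {T : ι → Module.End ℂ (MvPowerSeries (Fin n) ℂ)} (hT : ∀ i ∈ s, RaisesOrder k (T i)) :
    RaisesOrder k (∑ i ∈ s, T i) := fun p F hF => by
  rw [LinearMap.sum_apply]
  exact le_order_sum fun i hi => hT i hi p F hF

theorem RaisesOrder.smul {k : ℕ} {T : Module.End ℂ (MvPowerSeries (Fin n) ℂ)}
    (hT : RaisesOrder k T) (c : ℂ) : RaisesOrder k (c • T) := fun p F hF =>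
  (hT p F hF).trans le_order_smul

theorem RaisesOrder.neg {k : ℕ} {T : Module.End ℂ (MvPowerSeries (Fin n) ℂ)}
    (hT : RaisesOrder k T) : RaisesOrder k (-T) := fun p F hF => by
  rw [LinearMap.neg_apply, order_neg]
  exact hT p F hF

/-- The sum `∑ k, Φ k` of operators, where `Φ k` has degree at least `k`. -/
noncomputable def operatorSum (Φ : ℕ → Module.End ℂ (MvPowerSeries (Fin n) ℂ)) :
    Module.End ℂ (MvPowerSeries (Fin n) ℂ) where
  toFun F := adicSum fun k => Φ k F
  map_add' F G := by
    ext d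
    change ∑ k ∈ range (d.degree + 1), coeff d (Φ k (F + G)) =
      ∑ k ∈ range (d.degree + 1), coeff d (Φ k F) + ∑ k ∈ range (d.degree + 1), coeff d (Φ k G)
    simp [sum_add_distrib]
  map_smul' c F := by
    ext d
    change ∑ k ∈ range (d.degree + 1), coeff d (Φ k (c • F)) =
      c * ∑ k ∈ range (d.degree + 1), coeff d (Φ k F)
    simp [mul_sum]

theorem operatorSum_apply (Φ : ℕ → Module.End ℂ (MvPowerSeries (Fin n) ℂ))
    (F : MvPowerSeries (Fin n) ℂ) : operatorSum Φ F = adicSum fun k => Φ k F := rfl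

theorem operatorSum_mul {Φ Ψ : ℕ → Module.End ℂ (MvPowerSeries (Fin n) ℂ)}
    (hΦ : ∀ k, RaisesOrder k (Φ k)) (hΨ : ∀ k, RaisesOrder k (Ψ k)) :
    operatorSum Φ * operatorSum Ψ
      = operatorSum fun k => ∑ p ∈ antidiagonal k, Φ p.1 * Ψ p.2 := by
  refine LinearMap.ext fun F => ?_
  ext d
  have hsum : ∀ k, RaisesOrder k (∑ p ∈ antidiagonal k, Φ p.1 * Ψ p.2) := fun k =>
    RaisesOrder.sum fun p hp => by
      rw [← mem_antidiagonal.1 hp]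
      exact (hΦ _).mul (hΨ _)
  have hL := coeff_adicSum (fun k => (hΦ k).le_order (operatorSum Ψ F)) (Nat.lt_succ_self d.degree)
  have hR := coeff_adicSum (fun k => (hsum k).le_order F) (Nat.lt_succ_self d.degree)
  rw [Module.End.mul_apply, operatorSum_apply Φ, hL,
    operatorSum_apply (fun k => ∑ p ∈ antidiagonal k, Φ p.1 * Ψ p.2), hR, map_sum, map_sum]
  simp_rw [LinearMap.sum_apply, map_sum]
  rw [sum_range_sum_antidiagonal (fun i j => coeff d ((Φ i * Ψ j) F)) fun i j hij =>
    coeff_of_lt_order (lt_of_lt_of_le (by exact_mod_cast hij) (((hΦ i).mul (hΨ j)).le_order F))]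
  refine sum_congr rfl fun i _ => ?_
  -- Modulo terms of order above the degree of `d`, the inner sum may be truncated.
  have h := hΦ i _ _ (le_order_adicSum_sub (fun k => (hΨ k).le_order F) d.degree.succ)
  have h0 := coeff_of_lt_order (d := d) (lt_of_lt_of_le
    (by exact_mod_cast Nat.lt_of_lt_of_le (Nat.lt_succ_self _) (Nat.le_add_right _ i)) h)
  rw [map_sub, map_sub, sub_eq_zero] at h0
  rw [operatorSum_apply, h0, map_sum, map_sum]
  rfl

end MvPowerSeries

/-! ### Time-ordered exponentials -/

section TimeOrdered

theorem Finset.sum_antidiagonal_assoc {M : Type*} [AddCommMonoid M] (u : ℕ → ℕ → ℕ → M) (k : ℕ) :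
    ∑ p ∈ antidiagonal k, ∑ q ∈ antidiagonal p.1, u q.1 q.2 p.2
      = ∑ p ∈ antidiagonal k, ∑ q ∈ antidiagonal p.2, u p.1 q.1 q.2 := by
  rw [sum_sigma', sum_sigma']
  refine sum_nbij' (fun x => ⟨(x.2.1, x.2.2 + x.1.2), (x.2.2, x.1.2)⟩)
    (fun x => ⟨(x.1.1 + x.2.1, x.2.2), (x.1.1, x.2.1)⟩) ?_ ?_ ?_ ?_ ?_ <;>
  · rintro ⟨⟨a, b⟩, ⟨c, d⟩⟩ h
    simp only [mem_sigma, HasAntidiagonal.mem_antidiagonal, Sigma.mk.injEq, Prod.mk.injEq,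
      heq_eq_eq, and_true, true_and] at h ⊢ <;>
    omega

theorem Finset.sum_antidiagonal_right_comm {M : Type*} [AddCommMonoid M] (u : ℕ → ℕ → ℕ → M)
    (k : ℕ) :
    ∑ p ∈ antidiagonal k, ∑ q ∈ antidiagonal p.1, u q.1 q.2 p.2
      = ∑ p ∈ antidiagonal k, ∑ q ∈ antidiagonal p.1, u q.1 p.2 q.2 := by
  rw [sum_antidiagonal_assoc, sum_antidiagonal_assoc fun a b c => u a c b]
  refine sum_congr rfl fun p _ => ?_
  rw [← Nat.sum_antidiagonal_swap]
  rfl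

/-- The Leibniz rule for the derivative of a Cauchy product. -/
theorem Finset.smul_sum_antidiagonal_succ {M : Type*} [AddCommGroup M] [Module ℂ M]
    (b : ℕ → ℕ → M) (k : ℕ) :
    ((k : ℂ) + 1) • ∑ p ∈ antidiagonal (k + 1), b p.1 p.2
      = ∑ p ∈ antidiagonal k, (((p.1 : ℂ) + 1) • b (p.1 + 1) p.2 +
          ((p.2 : ℂ) + 1) • b p.1 (p.2 + 1)) := by
  have h : ((k : ℂ) + 1) • ∑ p ∈ antidiagonal (k + 1), b p.1 p.2
      = ∑ p ∈ antidiagonal (k + 1), (p.1 : ℂ) • b p.1 p.2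
        + ∑ p ∈ antidiagonal (k + 1), (p.2 : ℂ) • b p.1 p.2 := by
    rw [smul_sum, ← sum_add_distrib]
    refine sum_congr rfl fun p hp => ?_
    rw [← add_smul]
    congr 1
    exact_mod_cast (HasAntidiagonal.mem_antidiagonal.1 hp).symm
  rw [h, Nat.sum_antidiagonal_succ, Nat.sum_antidiagonal_succ', sum_add_distrib]
  simp

variable {A : Type*} [Ring A] [Algebra ℂ A]

/-- The Taylor coefficients in `t` of the solution of `Φ' = Φ ξ`, `Φ(0) = 1`, where
`ξ = ∑ t ^ k ξ k` has coefficients in a noncommutative algebra. -/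
noncomputable def timeOrderedExp (ξ : ℕ → A) : ℕ → A
  | 0 => 1
  | k + 1 => ((k : ℂ) + 1)⁻¹ • ∑ j : Fin (k + 1), timeOrderedExp ξ (k - j) * ξ j

theorem timeOrderedExp_zero (ξ : ℕ → A) : timeOrderedExp ξ 0 = 1 := by
  rw [timeOrderedExp]

theorem timeOrderedExp_succ (ξ : ℕ → A) (k : ℕ) :
    ((k : ℂ) + 1) • timeOrderedExp ξ (k + 1)
      = ∑ p ∈ antidiagonal k, timeOrderedExp ξ p.1 * ξ p.2 := by
  rw [timeOrderedExp, smul_inv_smul₀ (Nat.cast_add_one_ne_zero k),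
    Fin.sum_univ_eq_sum_range fun j => timeOrderedExp ξ (k - j) * ξ j, ← Nat.sum_antidiagonal_swap,
    Nat.sum_antidiagonal_eq_sum_range_succ_mk]
  rfl

/-- The Taylor coefficients in `t` of the solution of `Ψ' = - ξ Ψ`, `Ψ(0) = 1`, which is inverse
to `timeOrderedExp ξ`. It is the time-ordered exponential of `- ξ` in the opposite algebra. -/
noncomputable def timeOrderedExpInv (ξ : ℕ → A) (k : ℕ) : A :=
  (timeOrderedExp (fun k => MulOpposite.op (-ξ k)) k).unop

theorem timeOrderedExpInv_zero (ξ : ℕ → A) : timeOrderedExpInv ξ 0 = 1 := by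
  rw [timeOrderedExpInv, timeOrderedExp_zero, MulOpposite.unop_one]

theorem timeOrderedExpInv_succ (ξ : ℕ → A) (k : ℕ) :
    ((k : ℂ) + 1) • timeOrderedExpInv ξ (k + 1)
      = ∑ p ∈ antidiagonal k, -(ξ p.2 * timeOrderedExpInv ξ p.1) := by
  have h := congrArg MulOpposite.unop
    (timeOrderedExp_succ (fun k => MulOpposite.op (-ξ k)) k)
  rw [MulOpposite.unop_smul, Finset.unop_sum] at h
  refine h.trans (sum_congr rfl fun p _ => ?_)
  rw [MulOpposite.unop_mul, MulOpposite.unop_op, neg_mul]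
  rfl

theorem timeOrderedExp_mul_inv (ξ : ℕ → A) (k : ℕ) :
    ∑ p ∈ antidiagonal k, timeOrderedExp ξ p.1 * timeOrderedExpInv ξ p.2
      = if k = 0 then 1 else 0 := by
  rcases k with _ | k
  · simp [timeOrderedExp_zero, timeOrderedExpInv_zero]
  · rw [if_neg k.succ_ne_zero, ← smul_eq_zero_iff_right (Nat.cast_add_one_ne_zero (R := ℂ) k),
      smul_sum_antidiagonal_succ fun i j => timeOrderedExp ξ i * timeOrderedExpInv ξ j]
    have hp : ∀ p : ℕ × ℕ, ((p.1 : ℂ) + 1) • (timeOrderedExp ξ (p.1 + 1) * timeOrderedExpInv ξ p.2)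
        + ((p.2 : ℂ) + 1) • (timeOrderedExp ξ p.1 * timeOrderedExpInv ξ (p.2 + 1))
        = ∑ q ∈ antidiagonal p.1, timeOrderedExp ξ q.1 * ξ q.2 * timeOrderedExpInv ξ p.2
          + ∑ q ∈ antidiagonal p.2, timeOrderedExp ξ p.1 * -(ξ q.2 * timeOrderedExpInv ξ q.1) :=
      fun p => by
        rw [← smul_mul_assoc, ← mul_smul_comm, timeOrderedExp_succ, timeOrderedExpInv_succ,
          sum_mul, mul_sum]
    simp_rw [hp]
    rw [sum_add_distrib,
      sum_antidiagonal_assoc fun a b c => timeOrderedExp ξ a * ξ b * timeOrderedExpInv ξ c,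
      ← sum_add_distrib]
    refine sum_eq_zero fun p _ => ?_
    rw [← Nat.sum_antidiagonal_swap, ← sum_add_distrib]
    refine sum_eq_zero fun q _ => ?_
    simp [mul_assoc]

/-- `P = Ψ Φ` solves `P' = P ξ - ξ P` with `P(0) = 1`, so it is constant. -/
theorem timeOrderedExpInv_mul (ξ : ℕ → A) (k : ℕ) :
    ∑ p ∈ antidiagonal k, timeOrderedExpInv ξ p.1 * timeOrderedExp ξ p.2
      = if k = 0 then 1 else 0 := by
  induction k using Nat.strong_induction_on with
  | _ k ih =>
    rcases k with _ | k
    · simp [timeOrderedExp_zero, timeOrderedExpInv_zero]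
    · rw [if_neg k.succ_ne_zero, ← smul_eq_zero_iff_right (Nat.cast_add_one_ne_zero (R := ℂ) k),
        smul_sum_antidiagonal_succ fun i j => timeOrderedExpInv ξ i * timeOrderedExp ξ j]
      have hp : ∀ p : ℕ × ℕ,
          ((p.1 : ℂ) + 1) • (timeOrderedExpInv ξ (p.1 + 1) * timeOrderedExp ξ p.2)
          + ((p.2 : ℂ) + 1) • (timeOrderedExpInv ξ p.1 * timeOrderedExp ξ (p.2 + 1))
          = ∑ q ∈ antidiagonal p.1, -(ξ q.2 * timeOrderedExpInv ξ q.1) * timeOrderedExp ξ p.2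
            + ∑ q ∈ antidiagonal p.2, timeOrderedExpInv ξ p.1 * (timeOrderedExp ξ q.1 * ξ q.2) :=
        fun p => by
          rw [← smul_mul_assoc, ← mul_smul_comm, timeOrderedExp_succ, timeOrderedExpInv_succ,
            sum_mul, mul_sum]
      simp_rw [hp]
      rw [sum_add_distrib]
      have h1 : ∑ p ∈ antidiagonal k, ∑ q ∈ antidiagonal p.1,
          -(ξ q.2 * timeOrderedExpInv ξ q.1) * timeOrderedExp ξ p.2 = -ξ k := by
        rw [sum_antidiagonal_right_comm
          fun a b c => -(ξ b * timeOrderedExpInv ξ a) * timeOrderedExp ξ c]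
        simp_rw [neg_mul, mul_assoc, sum_neg_distrib, ← mul_sum]
        rw [sum_eq_single (0, k)]
        · simp [timeOrderedExp_zero, timeOrderedExpInv_zero]
        · intro p hp hne
          have hp' := HasAntidiagonal.mem_antidiagonal.1 hp
          have h0 : p.1 ≠ 0 := fun h0 => hne (Prod.ext h0 (by omega))
          rw [ih p.1 (by omega), if_neg h0, mul_zero]
        · simp
      have h2 : ∑ p ∈ antidiagonal k, ∑ q ∈ antidiagonal p.2,
          timeOrderedExpInv ξ p.1 * (timeOrderedExp ξ q.1 * ξ q.2) = ξ k := by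
        rw [← sum_antidiagonal_assoc
          fun a b c => timeOrderedExpInv ξ a * (timeOrderedExp ξ b * ξ c)]
        simp_rw [← mul_assoc, ← sum_mul]
        rw [sum_eq_single (0, k)]
        · simp [timeOrderedExp_zero, timeOrderedExpInv_zero]
        · intro p hp hne
          have hp' := HasAntidiagonal.mem_antidiagonal.1 hp
          have h0 : p.1 ≠ 0 := fun h0 => hne (Prod.ext h0 (by omega))
          rw [ih p.1 (by omega), if_neg h0, zero_mul]
        · simp
      rw [h1, h2, neg_add_cancel]

/-- The time-ordered exponential of derivations is multiplicative. -/
theorem timeOrderedExp_derivation_mul {S : Type*} [CommRing S] [Algebra ℂ S]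
    (D : ℕ → Derivation ℂ S S) (k : ℕ) (F G : S) :
    timeOrderedExp (fun j => ((D j : S →ₗ[ℂ] S) : Module.End ℂ S)) k (F * G)
      = ∑ p ∈ antidiagonal k,
        timeOrderedExp (fun j => ((D j : S →ₗ[ℂ] S) : Module.End ℂ S)) p.1 F *
        timeOrderedExp (fun j => ((D j : S →ₗ[ℂ] S) : Module.End ℂ S)) p.2 G := by
  set ξ : ℕ → Module.End ℂ S := fun j => (D j : S →ₗ[ℂ] S)
  have hξ : ∀ j F G, ξ j (F * G) = F * ξ j G + ξ j F * G := fun j F G => by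
    have := (D j).leibniz F G
    rw [smul_eq_mul, smul_eq_mul, mul_comm G] at this
    exact this
  have hsucc : ∀ (k : ℕ) F, ((k : ℂ) + 1) • timeOrderedExp ξ (k + 1) F
      = ∑ p ∈ antidiagonal k, timeOrderedExp ξ p.1 (ξ p.2 F) := fun k F => by
    rw [← LinearMap.smul_apply, timeOrderedExp_succ, LinearMap.sum_apply]
    rfl
  induction k using Nat.strong_induction_on generalizing F G with
  | _ k ih =>
    rcases k with _ | k
    · simp [timeOrderedExp_zero]
    · refine smul_right_injective S (Nat.cast_add_one_ne_zero (R := ℂ) k) ?_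
      dsimp only
      rw [hsucc, smul_sum_antidiagonal_succ fun i j => timeOrderedExp ξ i F * timeOrderedExp ξ j G]
      have hp : ∀ p : ℕ × ℕ,
          ((p.1 : ℂ) + 1) • (timeOrderedExp ξ (p.1 + 1) F * timeOrderedExp ξ p.2 G)
          + ((p.2 : ℂ) + 1) • (timeOrderedExp ξ p.1 F * timeOrderedExp ξ (p.2 + 1) G)
          = ∑ q ∈ antidiagonal p.1, timeOrderedExp ξ q.1 (ξ q.2 F) * timeOrderedExp ξ p.2 G
            + ∑ q ∈ antidiagonal p.2, timeOrderedExp ξ p.1 F * timeOrderedExp ξ q.1 (ξ q.2 G) :=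
        fun p => by rw [← smul_mul_assoc, ← mul_smul_comm, hsucc, hsucc, sum_mul, mul_sum]
      simp_rw [hp, hξ, map_add]
      rw [sum_add_distrib, sum_add_distrib, add_comm]
      congr 1
      · rw [sum_antidiagonal_right_comm
          fun a b c => timeOrderedExp ξ a (ξ b F) * timeOrderedExp ξ c G]
        exact sum_congr rfl fun p hp =>
          ih p.1 (Nat.lt_succ_of_le (HasAntidiagonal.antidiagonal.fst_le hp)) _ _
      · rw [← sum_antidiagonal_assoc
          fun a b c => timeOrderedExp ξ a F * timeOrderedExp ξ b (ξ c G)]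
        exact sum_congr rfl fun p hp =>
          ih p.1 (Nat.lt_succ_of_le (HasAntidiagonal.antidiagonal.fst_le hp)) _ _

/-- If the time-dependent operator `ξ = ∑ t ^ k ξ k` satisfies `ξ (f + t g) = - g`, then its
time-ordered exponential `Φ` has `Φ (f + t g)` constant, since the derivative is
`Φ (ξ (f + t g)) + Φ g = 0`. -/
theorem timeOrderedExp_apply_add {M : Type*} [AddCommGroup M] [Module ℂ M]
    (ξ : ℕ → Module.End ℂ M) {f g : M} (h0 : ξ 0 f = -g) (hs : ∀ j, ξ (j + 1) f = -ξ j g) (k : ℕ) :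
    timeOrderedExp ξ (k + 1) f + timeOrderedExp ξ k g = 0 := by
  have hsucc : ∀ (k : ℕ) F, ((k : ℂ) + 1) • timeOrderedExp ξ (k + 1) F
      = ∑ p ∈ antidiagonal k, timeOrderedExp ξ p.1 (ξ p.2 F) := fun k F => by
    rw [← LinearMap.smul_apply, timeOrderedExp_succ, LinearMap.sum_apply]
    rfl
  rw [← smul_eq_zero_iff_right (Nat.cast_add_one_ne_zero (R := ℂ) k), smul_add, hsucc]
  rcases k with _ | k
  · simp [timeOrderedExp_zero, h0]
  · rw [Nat.sum_antidiagonal_succ']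
    simp_rw [h0, hs, map_neg, sum_neg_distrib]
    rw [← hsucc, add_smul ((k + 1 : ℕ) : ℂ), one_smul]
    push_cast
    abel

end TimeOrdered

namespace MvPowerSeries

variable {n : ℕ}

/-! ### Cauchy estimates for operators -/

/-- A linear operator is Cauchy bounded of degree `m` on the polydisc of radius `ρ`, with constant
`c`, if on smaller polydiscs it obeys the estimate of an `m`-th derivative. -/
def CauchyBounded (ρ : ℝ≥0) (m : ℕ) (c : ℝ≥0∞) (T : Module.End ℂ (MvPowerSeries (Fin n) ℂ)) :
    Prop :=
  ∀ (r δ : ℝ≥0) (F : MvPowerSeries (Fin n) ℂ), r + δ ≤ ρ →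
    (δ : ℝ≥0∞) ^ m * polydiscNorm r (T F) ≤ c * polydiscNorm (r + δ) F

theorem cauchyBounded_one (ρ : ℝ≥0) :
    CauchyBounded ρ 0 1 (1 : Module.End ℂ (MvPowerSeries (Fin n) ℂ)) := fun r δ F _ => by
  simpa using polydiscNorm_mono le_self_add F

theorem CauchyBounded.neg {ρ : ℝ≥0} {m : ℕ} {c : ℝ≥0∞}
    {T : Module.End ℂ (MvPowerSeries (Fin n) ℂ)} (hT : CauchyBounded ρ m c T) :
    CauchyBounded ρ m c (-T) := fun r δ F h => by
  simpa using hT r δ F h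

theorem CauchyBounded.mul_aux {ρ : ℝ≥0} {m l : ℕ} {c b : ℝ≥0∞}
    {T U : Module.End ℂ (MvPowerSeries (Fin n) ℂ)} (hT : CauchyBounded ρ m c T)
    (hU : CauchyBounded ρ l b U) (r δ ε : ℝ≥0) (F : MvPowerSeries (Fin n) ℂ)
    (h : r + δ + ε ≤ ρ) :
    (δ : ℝ≥0∞) ^ m * (ε : ℝ≥0∞) ^ l * polydiscNorm r ((T * U) F)
      ≤ c * b * polydiscNorm (r + δ + ε) F :=
  calc _ = (ε : ℝ≥0∞) ^ l * ((δ : ℝ≥0∞) ^ m * polydiscNorm r (T (U F))) := by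
        rw [Module.End.mul_apply]
        ring
    _ ≤ (ε : ℝ≥0∞) ^ l * (c * polydiscNorm (r + δ) (U F)) := by
        gcongr (ε : ℝ≥0∞) ^ l * ?_
        exact hT _ _ _ (le_self_add.trans h)
    _ = c * ((ε : ℝ≥0∞) ^ l * polydiscNorm (r + δ) (U F)) := by ring
    _ ≤ c * (b * polydiscNorm (r + δ + ε) F) := by
        gcongr c * ?_
        exact hU _ _ _ h
    _ = _ := by ring

/-- The loss of radius `δ` is split between operators of degrees `m` and `1` in the proportion
`m : 1`; the resulting factor is `(m + 1) (1 + 1 / m) ^ m`, and `(1 + 1 / m) ^ m ≤ 3`. -/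
theorem exists_split_pow_le (m : ℕ) (δ : ℝ≥0) : ∃ δ₁ δ₂ : ℝ≥0, δ₁ + δ₂ = δ ∧
    δ ^ (m + 1) ≤ 3 * (m + 1) * (δ₁ ^ m * δ₂) := by
  refine ⟨m * δ / (m + 1), δ / (m + 1), by field_simp, ?_⟩
  have key : ((m : ℝ≥0) + 1) ^ m ≤ 3 * (m : ℝ≥0) ^ m := by
    rcases Nat.eq_zero_or_pos m with rfl | hm
    · norm_num
    · have hm' : (0 : ℝ) < m := by exact_mod_cast hm
      have h1 : (1 + 1 / (m : ℝ)) ^ m ≤ 3 := by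
        calc (1 + 1 / (m : ℝ)) ^ m ≤ Real.exp (1 / m) ^ m := by
              gcongr
              rw [add_comm]
              exact Real.add_one_le_exp _
          _ = Real.exp 1 := by
              rw [← Real.exp_nat_mul]
              congr 1
              field_simp
          _ ≤ 3 := by linarith [Real.exp_one_lt_d9]
      have h2 : ((m : ℝ) + 1) ^ m ≤ 3 * (m : ℝ) ^ m := by
        calc ((m : ℝ) + 1) ^ m = (1 + 1 / (m : ℝ)) ^ m * (m : ℝ) ^ m := by
              rw [← mul_pow]
              congr 1
              field_simp
          _ ≤ _ := by gcongr
      exact_mod_cast h2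
  have hpos : (0 : ℝ≥0) < (m : ℝ≥0) + 1 := by positivity
  calc δ ^ (m + 1) = ((m : ℝ≥0) + 1) ^ m * (δ ^ (m + 1) / ((m : ℝ≥0) + 1) ^ m) :=
        (mul_div_cancel₀ _ (pow_ne_zero _ hpos.ne')).symm
    _ ≤ 3 * (m : ℝ≥0) ^ m * (δ ^ (m + 1) / ((m : ℝ≥0) + 1) ^ m) := by gcongr
    _ = _ := by
        rw [div_pow, mul_pow, pow_succ δ]
        field_simp

theorem CauchyBounded.mul_one {ρ : ℝ≥0} {m : ℕ} {c b : ℝ≥0∞}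
    {T U : Module.End ℂ (MvPowerSeries (Fin n) ℂ)} (hT : CauchyBounded ρ m c T)
    (hU : CauchyBounded ρ 1 b U) : CauchyBounded ρ (m + 1) (3 * (m + 1) * (c * b)) (T * U) := by
  intro r δ F h
  obtain ⟨δ₁, δ₂, hδ, hle⟩ := exists_split_pow_le m δ
  have h1 := hT.mul_aux hU r δ₁ δ₂ F (by rwa [add_assoc, hδ])
  rw [add_assoc, hδ, pow_one] at h1
  have h2 : (δ : ℝ≥0∞) ^ (m + 1) ≤ 3 * (m + 1) * ((δ₁ : ℝ≥0∞) ^ m * δ₂) := by exact_mod_cast hle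
  calc _ ≤ 3 * (m + 1) * ((δ₁ : ℝ≥0∞) ^ m * δ₂) * polydiscNorm r ((T * U) F) := by gcongr
    _ = 3 * (m + 1) * ((δ₁ : ℝ≥0∞) ^ m * δ₂ * polydiscNorm r ((T * U) F)) := by ring
    _ ≤ 3 * (m + 1) * (c * b * polydiscNorm (r + δ) F) := by gcongr
    _ = _ := by ring

theorem CauchyBounded.one_mul {ρ : ℝ≥0} {m : ℕ} {c b : ℝ≥0∞}
    {T U : Module.End ℂ (MvPowerSeries (Fin n) ℂ)} (hT : CauchyBounded ρ m c T)
    (hU : CauchyBounded ρ 1 b U) : CauchyBounded ρ (m + 1) (3 * (m + 1) * (c * b)) (U * T) := by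
  intro r δ F h
  obtain ⟨δ₁, δ₂, hδ, hle⟩ := exists_split_pow_le m δ
  have h1 := hU.mul_aux hT r δ₂ δ₁ F (by rwa [add_assoc, add_comm δ₂, hδ])
  rw [add_assoc, add_comm δ₂, hδ, pow_one] at h1
  have h2 : (δ : ℝ≥0∞) ^ (m + 1) ≤ 3 * (m + 1) * ((δ₁ : ℝ≥0∞) ^ m * δ₂) := by exact_mod_cast hle
  calc _ ≤ 3 * (m + 1) * ((δ₁ : ℝ≥0∞) ^ m * δ₂) * polydiscNorm r ((U * T) F) := by gcongr
    _ = 3 * (m + 1) * (δ₂ * (δ₁ : ℝ≥0∞) ^ m * polydiscNorm r ((U * T) F)) := by ring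
    _ ≤ 3 * (m + 1) * (b * c * polydiscNorm (r + δ) F) := by gcongr
    _ = _ := by ring

/-- The Taylor coefficients of a flow are Cauchy bounded with geometrically growing constants,
if the coefficients of the vector field are. -/
theorem cauchyBounded_of_recursion {ρ : ℝ≥0} {B : ℝ≥0∞} {b : ℕ → ℝ≥0∞}
    {Θ : ℕ → Module.End ℂ (MvPowerSeries (Fin n) ℂ)}
    {X : ℕ → ℕ → Module.End ℂ (MvPowerSeries (Fin n) ℂ)} (h0 : Θ 0 = 1)
    (hs : ∀ k : ℕ, ((k : ℂ) + 1) • Θ (k + 1) = ∑ p ∈ antidiagonal k, X p.1 p.2)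
    (hX : ∀ (i j : ℕ) (c : ℝ≥0∞), CauchyBounded ρ i c (Θ i) →
      CauchyBounded ρ (i + 1) (3 * (i + 1) * (c * b j)) (X i j))
    (hb : ∀ j, 3 * ((ρ : ℝ≥0∞) ^ j * b j) ≤ 2⁻¹ ^ (j + 1) * B ^ (j + 1)) (k : ℕ) :
    CauchyBounded ρ k (B ^ k) (Θ k) := by
  induction k using Nat.strong_induction_on with
  | _ k ih =>
    rcases k with _ | k
    · rw [h0, pow_zero]
      exact cauchyBounded_one ρ
    · intro r δ F h
      have hδ : (δ : ℝ≥0∞) ≤ ρ := by exact_mod_cast le_add_self.trans h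
      have hk : ‖((k : ℂ) + 1)‖ₑ = (k : ℝ≥0∞) + 1 := by
        have : ((k : ℂ) + 1) = ((k + 1 : ℕ) : ℂ) := by push_cast; ring
        rw [this, ← ofReal_norm, Complex.norm_natCast, ENNReal.ofReal_natCast]
        push_cast
        rfl
      have hterm : ∀ p ∈ antidiagonal k, (δ : ℝ≥0∞) ^ (k + 1) * polydiscNorm r (X p.1 p.2 F)
          ≤ 2⁻¹ ^ (p.2 + 1) * (((k : ℝ≥0∞) + 1) * (B ^ (k + 1) * polydiscNorm (r + δ) F)) := by
        intro p hp
        have hpk := HasAntidiagonal.mem_antidiagonal.1 hp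
        have h1 := hX p.1 p.2 _ (ih p.1 (by omega)) r δ F h
        calc (δ : ℝ≥0∞) ^ (k + 1) * polydiscNorm r (X p.1 p.2 F)
            = (δ : ℝ≥0∞) ^ p.2 * ((δ : ℝ≥0∞) ^ (p.1 + 1) * polydiscNorm r (X p.1 p.2 F)) := by
              rw [← hpk]
              ring
          _ ≤ (ρ : ℝ≥0∞) ^ p.2 *
              (3 * ((p.1 : ℝ≥0∞) + 1) * (B ^ p.1 * b p.2) * polydiscNorm (r + δ) F) := by
              gcongr
          _ = ((p.1 : ℝ≥0∞) + 1) * B ^ p.1 * (3 * ((ρ : ℝ≥0∞) ^ p.2 * b p.2)) *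
              polydiscNorm (r + δ) F := by ring
          _ ≤ ((k : ℝ≥0∞) + 1) * B ^ p.1 * (2⁻¹ ^ (p.2 + 1) * B ^ (p.2 + 1)) *
              polydiscNorm (r + δ) F := by
              gcongr ((?_ : ℝ≥0∞) + 1) * B ^ p.1 * ?_ * polydiscNorm (r + δ) F
              · exact_mod_cast hpk ▸ Nat.le_add_right _ _
              · exact hb _
          _ = _ := by
              rw [← hpk]
              ring
      have hgeom : ∑ p ∈ antidiagonal k, (2⁻¹ : ℝ≥0∞) ^ (p.2 + 1) ≤ 1 := by
        rw [← Nat.sum_antidiagonal_swap, Nat.sum_antidiagonal_eq_sum_range_succ_mk]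
        refine (ENNReal.sum_le_tsum _).trans ?_
        simp only [Prod.snd_swap]
        rw [ENNReal.tsum_geometric_add_one, ENNReal.one_sub_inv_two, inv_inv,
          ENNReal.inv_mul_cancel two_ne_zero ENNReal.ofNat_ne_top]
      have hmain : ((k : ℝ≥0∞) + 1) * ((δ : ℝ≥0∞) ^ (k + 1) * polydiscNorm r (Θ (k + 1) F))
          ≤ ((k : ℝ≥0∞) + 1) * (B ^ (k + 1) * polydiscNorm (r + δ) F) :=
        calc _ = (δ : ℝ≥0∞) ^ (k + 1) * polydiscNorm r ((((k : ℂ) + 1) • Θ (k + 1)) F) := by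
              rw [LinearMap.smul_apply, polydiscNorm_smul, hk]
              ring
          _ ≤ ∑ p ∈ antidiagonal k, (δ : ℝ≥0∞) ^ (k + 1) * polydiscNorm r (X p.1 p.2 F) := by
              rw [hs, LinearMap.sum_apply, ← mul_sum]
              gcongr
              exact polydiscNorm_sum_le _ _ _
          _ ≤ (∑ p ∈ antidiagonal k, (2⁻¹ : ℝ≥0∞) ^ (p.2 + 1)) *
              (((k : ℝ≥0∞) + 1) * (B ^ (k + 1) * polydiscNorm (r + δ) F)) := by
              rw [sum_mul]
              exact sum_le_sum hterm
          _ ≤ 1 * _ := by gcongr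
          _ = _ := _root_.one_mul _
      exact (ENNReal.mul_le_mul_iff_right (by positivity) (by finiteness)).1 hmain

/-- The coefficient of `t ^ k` in a flow raises orders by `k`, if the coefficient of `t ^ j` in the
vector field raises them by `j + 1`. -/
theorem raisesOrder_of_recursion {Θ : ℕ → Module.End ℂ (MvPowerSeries (Fin n) ℂ)}
    {X : ℕ → ℕ → Module.End ℂ (MvPowerSeries (Fin n) ℂ)} (h0 : Θ 0 = 1)
    (hs : ∀ k : ℕ, ((k : ℂ) + 1) • Θ (k + 1) = ∑ p ∈ antidiagonal k, X p.1 p.2)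
    (hX : ∀ i j : ℕ, RaisesOrder i (Θ i) → RaisesOrder (i + (j + 1)) (X i j)) (k : ℕ) :
    RaisesOrder k (Θ k) := by
  induction k using Nat.strong_induction_on with
  | _ k ih =>
    rcases k with _ | k
    · rw [h0]
      exact fun p F hF => hF
    · rw [← inv_smul_smul₀ (Nat.cast_add_one_ne_zero (R := ℂ) k) (Θ (k + 1)), hs]
      refine RaisesOrder.smul (RaisesOrder.sum fun p hp => ?_) _
      have hpk := HasAntidiagonal.mem_antidiagonal.1 hp
      have h := hX p.1 p.2 (ih p.1 (by omega))
      rwa [← add_assoc, hpk] at h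

/-- With the constants `(r / 4) ^ k`, the Cauchy estimate from radius `r` to radius `r / 2` bounds
the `k`-th term by `2⁻ᵏ`. The estimate is needed for all small `r`, as `F` may have any radius of
convergence. -/
theorem isConvergent_operatorSum {Φ : ℕ → Module.End ℂ (MvPowerSeries (Fin n) ℂ)}
    (hΦ : ∀ k, RaisesOrder k (Φ k)) {ρ : ℝ≥0} (hρ : 0 < ρ)
    (hb : ∀ r ≤ ρ, ∀ k, CauchyBounded r k (((r / 4 : ℝ≥0) : ℝ≥0∞) ^ k) (Φ k))
    {F : MvPowerSeries (Fin n) ℂ} (hF : F.IsConvergent) : (operatorSum Φ F).IsConvergent := by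
  rw [isConvergent_iff_polydiscNorm_ne_top] at hF ⊢
  obtain ⟨s, hs, hF⟩ := hF
  set r := min s ρ
  have hr0 : 0 < r := lt_min hs hρ
  refine ⟨r / 2, by positivity, ?_⟩
  have hFr : polydiscNorm r F ≠ ∞ :=
    ((polydiscNorm_mono (min_le_left s ρ) F).trans_lt hF.lt_top).ne
  have hk : ∀ k, polydiscNorm (r / 2) (Φ k F) ≤ 2⁻¹ ^ k * polydiscNorm r F := by
    intro k
    have h := hb r (min_le_right s ρ) k (r / 2) (r / 2) F (by rw [add_halves])
    rw [add_halves] at h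
    have h4 : r / 4 = r / 2 * 2⁻¹ := by
      rw [div_mul_eq_mul_div, div_eq_div_iff (by norm_num) (by norm_num), mul_assoc]
      norm_num
    have h2 : ((2⁻¹ : ℝ≥0) : ℝ≥0∞) = 2⁻¹ := by simp
    rw [h4, ENNReal.coe_mul, h2, mul_pow, mul_assoc] at h
    refine (ENNReal.mul_le_mul_iff_right ?_ ?_).1 h
    · exact pow_ne_zero _ (by exact_mod_cast (half_pos hr0).ne')
    · exact ENNReal.pow_ne_top ENNReal.coe_ne_top
  rw [operatorSum_apply]
  refine ne_top_of_le_ne_top ?_ ((polydiscNorm_adicSum_le _ fun k => (hΦ k).le_order F).trans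
    (ENNReal.tsum_le_tsum hk))
  rw [ENNReal.tsum_mul_right, ENNReal.tsum_geometric, ENNReal.one_sub_inv_two, inv_inv]
  exact ENNReal.mul_ne_top ENNReal.ofNat_ne_top hFr

/-! ### Flows of vector fields -/

/-- The vector field `∑ i, a i ∂ᵢ`, as a derivation of the formal power series ring. -/
noncomputable def vectorField (a : Fin n → MvPowerSeries (Fin n) ℂ) :
    Derivation ℂ (MvPowerSeries (Fin n) ℂ) (MvPowerSeries (Fin n) ℂ) :=
  ∑ i, a i • pderiv ℂ i

theorem vectorField_apply (a : Fin n → MvPowerSeries (Fin n) ℂ) (F : MvPowerSeries (Fin n) ℂ) :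
    vectorField a F = ∑ i, a i * pderiv ℂ i F := by
  rw [vectorField, ← Derivation.coeFnAddMonoidHom_apply, map_sum, Finset.sum_apply]
  rfl

theorem le_order_pderiv {F : MvPowerSeries (Fin n) ℂ} {p : ℕ} (hF : ((p + 1 : ℕ) : ℕ∞) ≤ F.order)
    (i : Fin n) : p ≤ (pderiv ℂ i F).order :=
  le_order fun d hd => by
    rw [coeff_pderiv, coeff_of_lt_order (lt_of_lt_of_le ?_ hF), zero_mul]
    have : (d + Finsupp.single i 1).degree = d.degree + 1 := by simp
    rw [this]
    exact_mod_cast Nat.succ_lt_succ (by exact_mod_cast hd)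

theorem raisesOrder_vectorField {a : Fin n → MvPowerSeries (Fin n) ℂ} {j : ℕ}
    (ha : ∀ i, ((j + 1 : ℕ) : ℕ∞) ≤ (a i).order) :
    RaisesOrder j ((vectorField a : _ →ₗ[ℂ] _) : Module.End ℂ (MvPowerSeries (Fin n) ℂ)) := by
  intro p F hF
  change _ ≤ (vectorField a F).order
  rw [vectorField_apply]
  refine le_order_sum fun i _ => ?_
  have h : ((p - 1 : ℕ) : ℕ∞) ≤ (pderiv ℂ i F).order := by
    rcases p with _ | p
    · simp
    · exact le_order_pderiv hF i
  refine le_trans ?_ ((add_le_add (ha i) h).trans le_order_mul)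
  norm_cast
  omega

theorem cauchyBounded_vectorField (ρ : ℝ≥0) (a : Fin n → MvPowerSeries (Fin n) ℂ) :
    CauchyBounded ρ 1 (∑ i, polydiscNorm ρ (a i))
      ((vectorField a : _ →ₗ[ℂ] _) : Module.End ℂ (MvPowerSeries (Fin n) ℂ)) := by
  intro r δ F h
  change _ * polydiscNorm r (vectorField a F) ≤ _
  rw [vectorField_apply, pow_one]
  calc _ ≤ (δ : ℝ≥0∞) * ∑ i, polydiscNorm ρ (a i) * polydiscNorm r (pderiv ℂ i F) := by
        gcongr
        refine (polydiscNorm_sum_le _ _ _).trans (sum_le_sum fun i _ => ?_)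
        refine (polydiscNorm_mul_le _ _ _).trans ?_
        gcongr
        exact polydiscNorm_mono (le_self_add.trans h) _
    _ = ∑ i, polydiscNorm ρ (a i) * (δ * polydiscNorm r (pderiv ℂ i F)) := by
        rw [mul_sum]
        exact sum_congr rfl fun i _ => by ring
    _ ≤ ∑ i, polydiscNorm ρ (a i) * polydiscNorm (r + δ) F := by
        gcongr
        exact mul_polydiscNorm_pderiv_le _ _ _ _
    _ = _ := by rw [sum_mul]

/-- If a time-dependent vector field `ξ = ∑ t ^ j ξ j`, with the coefficients of `ξ j` of order at
least `j + 2` and of norm `O(8⁻ʲ)`, satisfies `ξ (f + t g) = - g`, then its flow at time one is an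
automorphism of the convergent power series that maps `f + g` to `f`. -/
theorem exists_algEquiv_of_vectorField {f g : ConvergentSeries n}
    (a : ℕ → Fin n → MvPowerSeries (Fin n) ℂ)
    (hord : ∀ j i, ((j + 2 : ℕ) : ℕ∞) ≤ (a j i).order) {ρ : ℝ≥0} (hρ : 0 < ρ) {M : ℝ≥0}
    (hM : ∀ j i, polydiscNorm ρ (a j i) ≤ M * 8⁻¹ ^ j)
    (h0 : vectorField (a 0) f.1 = -g.1)
    (hs : ∀ j, vectorField (a (j + 1)) f.1 = -vectorField (a j) g.1) :
    ∃ φ : ConvergentSeries n ≃ₐ[ℂ] ConvergentSeries n, φ (f + g) = f := by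
  set ξ : ℕ → Module.End ℂ (MvPowerSeries (Fin n) ℂ) :=
    fun j => (vectorField (a j) : _ →ₗ[ℂ] _)
  set Φ := timeOrderedExp ξ
  set Ψ := timeOrderedExpInv ξ
  have hξr : ∀ j, RaisesOrder (j + 1) (ξ j) := fun j => raisesOrder_vectorField (hord j)
  have hΦr : ∀ k, RaisesOrder k (Φ k) :=
    raisesOrder_of_recursion (timeOrderedExp_zero ξ) (timeOrderedExp_succ ξ)
      (X := fun i j => Φ i * ξ j) fun i j h => h.mul (hξr j)
  have hΨr : ∀ k, RaisesOrder k (Ψ k) :=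
    raisesOrder_of_recursion (timeOrderedExpInv_zero ξ) (timeOrderedExpInv_succ ξ)
      (X := fun i j => -(ξ j * Ψ i)) fun i j h => by
        rw [add_comm]
        exact ((hξr j).mul h).neg
  have hid : (operatorSum fun k => if k = 0 then 1 else 0) =
      (1 : Module.End ℂ (MvPowerSeries (Fin n) ℂ)) := by
    refine LinearMap.ext fun F => MvPowerSeries.ext fun d => ?_
    change ∑ k ∈ range (d.degree + 1), coeff d ((if k = 0 then
      (1 : Module.End ℂ (MvPowerSeries (Fin n) ℂ)) else 0) F) = _
    rw [sum_eq_single 0]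
    · simp
    · intro k _ hk
      simp [hk]
    · simp
  have hΦΨ : operatorSum Φ * operatorSum Ψ = 1 := by
    rw [operatorSum_mul hΦr hΨr, ← hid]
    exact congrArg operatorSum (funext (timeOrderedExp_mul_inv ξ))
  have hΨΦ : operatorSum Ψ * operatorSum Φ = 1 := by
    rw [operatorSum_mul hΨr hΦr, ← hid]
    exact congrArg operatorSum (funext (timeOrderedExpInv_mul ξ))
  have hΦΨa : ∀ F, operatorSum Φ (operatorSum Ψ F) = F := fun F => LinearMap.congr_fun hΦΨ F
  have hΨΦa : ∀ F, operatorSum Ψ (operatorSum Φ F) = F := fun F => LinearMap.congr_fun hΨΦ F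
  have hmul : ∀ F G, operatorSum Φ (F * G) = operatorSum Φ F * operatorSum Φ G := by
    intro F G
    simp_rw [operatorSum_apply]
    rw [adicSum_mul (fun k => (hΦr k).le_order F) fun k => (hΦr k).le_order G]
    exact congrArg adicSum
      (funext fun k => timeOrderedExp_derivation_mul (fun j => vectorField (a j)) k F G)
  -- A surjective multiplicative map preserves the unit.
  have hone : operatorSum Φ 1 = 1 := by
    have h := hmul 1 (operatorSum Ψ 1)
    rwa [_root_.one_mul, hΦΨa, _root_.mul_one, eq_comm] at h
  -- As the coefficients of `ξ j` have order at least two, they have norm `O(r ^ 2)` on the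
  -- polydisc of radius `r`, so that the flow exists up to time one on all small polydiscs.
  obtain ⟨σ, hσ0, hσρ, hσ⟩ : ∃ σ : ℝ≥0, 0 < σ ∧ σ ≤ ρ ∧ 24 * n * M * σ ≤ ρ ^ 2 := by
    refine ⟨min ρ (ρ ^ 2 / (24 * n * M + 1)), lt_min hρ (by positivity), min_le_left _ _, ?_⟩
    calc 24 * n * M * min ρ (ρ ^ 2 / (24 * n * M + 1))
        ≤ (24 * n * M + 1) * (ρ ^ 2 / (24 * n * M + 1)) := by
          gcongr
          · exact le_self_add
          · exact min_le_right _ _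
      _ = ρ ^ 2 := by field_simp
  have hb : ∀ r ≤ σ, ∀ j, 3 * ((r : ℝ≥0∞) ^ j * ∑ i, polydiscNorm r (a j i))
      ≤ 2⁻¹ ^ (j + 1) * ((r / 4 : ℝ≥0) : ℝ≥0∞) ^ (j + 1) := by
    intro r hr j
    have hρ0 : (ρ : ℝ≥0∞) ^ 2 ≠ 0 := pow_ne_zero _ (by exact_mod_cast hρ.ne')
    refine (ENNReal.mul_le_mul_iff_right hρ0 (ENNReal.pow_ne_top ENNReal.coe_ne_top)).1 ?_
    have hi : ∀ i, (ρ : ℝ≥0∞) ^ 2 * polydiscNorm r (a j i) ≤ (r : ℝ≥0∞) ^ 2 * (M * 8⁻¹ ^ j) :=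
      fun i => (polydiscNorm_le_of_le_order (p := 2) (le_trans (by norm_cast; omega) (hord j i))
        (hr.trans hσρ)).trans (by gcongr; exact hM j i)
    calc (ρ : ℝ≥0∞) ^ 2 * (3 * ((r : ℝ≥0∞) ^ j * ∑ i, polydiscNorm r (a j i)))
        = 3 * ((r : ℝ≥0∞) ^ j * ∑ i, (ρ : ℝ≥0∞) ^ 2 * polydiscNorm r (a j i)) := by
          rw [← mul_sum]
          ring
      _ ≤ 3 * ((r : ℝ≥0∞) ^ j * ∑ i : Fin n, (r : ℝ≥0∞) ^ 2 * (M * 8⁻¹ ^ j)) := by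
          gcongr 3 * ((r : ℝ≥0∞) ^ j * ?_)
          exact sum_le_sum fun i _ => hi i
      _ = ((3 * (r ^ j * (n * (r ^ 2 * (M * 8⁻¹ ^ j)))) : ℝ≥0) : ℝ≥0∞) := by
          rw [sum_const, card_univ, Fintype.card_fin, nsmul_eq_mul]
          push_cast
          rw [ENNReal.coe_inv (by norm_num)]
          norm_num
      _ ≤ ((ρ ^ 2 * (2⁻¹ ^ (j + 1) * (r / 4) ^ (j + 1)) : ℝ≥0) : ℝ≥0∞) := by
          refine ENNReal.coe_le_coe.2 ?_
          calc 3 * (r ^ j * (n * (r ^ 2 * (M * 8⁻¹ ^ j))))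
              = 24 * n * M * r * (8⁻¹ ^ (j + 1) * r ^ (j + 1)) := by
                rw [pow_succ 8⁻¹ j, pow_succ r j]
                field_simp
                ring
            _ ≤ ρ ^ 2 * (8⁻¹ ^ (j + 1) * r ^ (j + 1)) := by
                gcongr
                exact le_trans (by gcongr) hσ
            _ = _ := by
                rw [← mul_pow, ← mul_pow]
                congr 2
                rw [div_eq_mul_inv, mul_left_comm, ← mul_inv]
                norm_num [mul_comm]
      _ = _ := by
          push_cast
          rfl
  have hξb : ∀ r j, CauchyBounded r 1 (∑ i, polydiscNorm r (a j i)) (ξ j) :=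
    fun r j => cauchyBounded_vectorField r (a j)
  have hΦc : ∀ F : MvPowerSeries (Fin n) ℂ, F.IsConvergent → (operatorSum Φ F).IsConvergent :=
    fun F => isConvergent_operatorSum hΦr hσ0 fun r hr =>
      cauchyBounded_of_recursion (timeOrderedExp_zero ξ) (timeOrderedExp_succ ξ)
        (X := fun i j => Φ i * ξ j) (fun i j c h => h.mul_one (hξb r j)) (hb r hr)
  have hΨc : ∀ F : MvPowerSeries (Fin n) ℂ, F.IsConvergent → (operatorSum Ψ F).IsConvergent :=
    fun F => isConvergent_operatorSum hΨr hσ0 fun r hr =>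
      cauchyBounded_of_recursion (timeOrderedExpInv_zero ξ) (timeOrderedExpInv_succ ξ)
        (X := fun i j => -(ξ j * Ψ i)) (fun i j c h => (h.one_mul (hξb r j)).neg) (hb r hr)
  let e : ConvergentSeries n ≃ₗ[ℂ] ConvergentSeries n :=
    { toFun := fun F => ⟨operatorSum Φ F.1, hΦc _ F.2⟩
      map_add' := fun F G => Subtype.ext (map_add (operatorSum Φ) F.1 G.1)
      map_smul' := fun c F => Subtype.ext (map_smul (operatorSum Φ) c F.1)
      invFun := fun F => ⟨operatorSum Ψ F.1, hΨc _ F.2⟩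
      left_inv := fun F => Subtype.ext (hΨΦa F.1)
      right_inv := fun F => Subtype.ext (hΦΨa F.1) }
  refine ⟨AlgEquiv.ofLinearEquiv e (Subtype.ext hone) fun F G => Subtype.ext (hmul F.1 G.1),
    Subtype.ext ?_⟩
  change operatorSum Φ (f.1 + g.1) = f.1
  ext d
  have hΦ0 : Φ 0 = 1 := timeOrderedExp_zero ξ
  have hk : ∀ k, Φ (k + 1) f.1 = -Φ k g.1 := fun k =>
    eq_neg_of_add_eq_zero_left (timeOrderedExp_apply_add ξ h0 hs k)
  rw [map_add, map_add, operatorSum_apply, operatorSum_apply,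
    coeff_adicSum (fun k => (hΦr k).le_order f.1) (N := d.degree + 1 + 1) (by omega),
    coeff_adicSum (fun k => (hΦr k).le_order g.1) (N := d.degree + 1) (by omega), ← map_add,
    sum_range_succ', add_right_comm, ← sum_add_distrib]
  simp [hk, hΦ0]

/-! ### Small polydiscs -/

theorem IsConvergent.eventually_polydiscNorm_ne_top {F : MvPowerSeries (Fin n) ℂ}
    (hF : F.IsConvergent) : ∀ᶠ r in nhdsWithin (0 : ℝ≥0) (Set.Ioi 0), polydiscNorm r F ≠ ∞ := by
  obtain ⟨s, hs, h⟩ := isConvergent_iff_polydiscNorm_ne_top.1 hF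
  filter_upwards [Ioo_mem_nhdsGT hs] with r hr
  exact ((polydiscNorm_mono hr.2.le F).trans_lt h.lt_top).ne

theorem IsConvergent.eventually_mul_polydiscNorm_le {F : MvPowerSeries (Fin n) ℂ}
    (hF : F.IsConvergent) {p : ℕ} (hp : ((p + 1 : ℕ) : ℕ∞) ≤ F.order) (C : ℝ≥0) :
    ∀ᶠ r in nhdsWithin (0 : ℝ≥0) (Set.Ioi 0), C * polydiscNorm r F ≤ (r : ℝ≥0∞) ^ p := by
  obtain ⟨s, hs, h⟩ := isConvergent_iff_polydiscNorm_ne_top.1 hF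
  obtain ⟨L, hL⟩ : ∃ L : ℝ≥0, (L : ℝ≥0∞) = polydiscNorm s F := ⟨_, ENNReal.coe_toNNReal h⟩
  have ht : 0 < min s (s ^ (p + 1) / (C * L + 1)) := lt_min hs (by positivity)
  filter_upwards [Ioo_mem_nhdsGT ht] with r hr
  have h1 := polydiscNorm_le_of_le_order hp (hr.2.le.trans (min_le_left _ _))
  have h2 : C * L * r ≤ s ^ (p + 1) :=
    calc C * L * r ≤ (C * L + 1) * (s ^ (p + 1) / (C * L + 1)) := by
          gcongr
          · exact le_self_add
          · exact hr.2.le.trans (min_le_right _ _)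
      _ = s ^ (p + 1) := by field_simp
  have hs0 : (s : ℝ≥0∞) ^ (p + 1) ≠ 0 := pow_ne_zero _ (by exact_mod_cast hs.ne')
  refine (ENNReal.mul_le_mul_iff_right hs0 (ENNReal.pow_ne_top ENNReal.coe_ne_top)).1 ?_
  calc (s : ℝ≥0∞) ^ (p + 1) * (C * polydiscNorm r F)
      = C * ((s : ℝ≥0∞) ^ (p + 1) * polydiscNorm r F) := by ring
    _ ≤ C * ((r : ℝ≥0∞) ^ (p + 1) * L) := by
        rw [hL]
        gcongr
    _ = ((C * L * r : ℝ≥0) : ℝ≥0∞) * (r : ℝ≥0∞) ^ p := by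
        push_cast
        ring
    _ ≤ ((s ^ (p + 1) : ℝ≥0) : ℝ≥0∞) * (r : ℝ≥0∞) ^ p := by gcongr
    _ = _ := by push_cast; rfl

end MvPowerSeries

namespace ConvergentSeries

open MvPowerSeries

variable {n : ℕ}

/-! ### Membership in the Jacobian ideal -/

theorem isUnit_one_sub {z : ConvergentSeries n} (hz : constantCoeff z.1 = 0) :
    IsUnit (1 - z) := by
  have h1 : ((1 : ℕ) : ℕ∞) ≤ z.1.order := by
    exact_mod_cast one_le_order_iff_constCoeff_eq_zero.2 hz
  have hk : ∀ k : ℕ, (k : ℕ∞) ≤ (z.1 ^ k).order := fun k =>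
    le_order_pow_of_constantCoeff_eq_zero k hz
  have hG : (adicSum fun k => z.1 ^ k).IsConvergent := by
    obtain ⟨r, hr, hr0⟩ := ((z.2.eventually_mul_polydiscNorm_le (p := 0) h1 2).and
      self_mem_nhdsWithin).exists
    have hr2 : polydiscNorm r z.1 ≤ 2⁻¹ := by
      rw [pow_zero] at hr
      rw [ENNReal.le_inv_iff_mul_le, mul_comm]
      exact_mod_cast hr
    have hpow : ∀ k : ℕ, polydiscNorm r (z.1 ^ k) ≤ 2⁻¹ ^ k := by
      intro k
      induction k with
      | zero => simpa using polydiscNorm_one_le r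
      | succ k ih =>
        rw [pow_succ, pow_succ]
        exact (polydiscNorm_mul_le _ _ _).trans (mul_le_mul' ih hr2)
    refine isConvergent_iff_polydiscNorm_ne_top.2 ⟨r, hr0, ne_top_of_le_ne_top ?_
      ((polydiscNorm_adicSum_le r hk).trans (ENNReal.tsum_le_tsum hpow))⟩
    rw [ENNReal.tsum_geometric, ENNReal.one_sub_inv_two, inv_inv]
    exact ENNReal.ofNat_ne_top
  refine IsUnit.of_mul_eq_one ⟨_, hG⟩ (Subtype.ext (MvPowerSeries.ext fun d => ?_))
  change coeff d ((1 - z.1) * adicSum fun k => z.1 ^ k) = coeff d 1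
  set N := d.degree + 1
  have hE : coeff d ((1 - z.1) * ((adicSum fun k => z.1 ^ k) - ∑ k ∈ range N, z.1 ^ k)) = 0 :=
    coeff_of_lt_order (lt_of_lt_of_le (by exact_mod_cast Nat.lt_succ_self _)
      ((le_order_adicSum_sub hk N).trans (le_add_self.trans le_order_mul)))
  have hz : coeff d (z.1 ^ N) = 0 :=
    coeff_of_lt_order (lt_of_lt_of_le (by exact_mod_cast Nat.lt_succ_self _) (hk N))
  rwa [mul_sub, mul_neg_geom_sum, map_sub, map_sub, hz, sub_zero, sub_eq_zero] at hE

theorem isUnit_of_constantCoeff_ne_zero {u : ConvergentSeries n} (hu : constantCoeff u.1 ≠ 0) :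
    IsUnit u := by
  have h : IsUnit (1 - (1 - (constantCoeff u.1)⁻¹ • u)) := by
    refine isUnit_one_sub ?_
    change constantCoeff (1 - (constantCoeff u.1)⁻¹ • u.1) = 0
    simp [hu]
  rw [sub_sub_cancel] at h
  have h2 := h.smul (Units.mk0 _ hu)
  rwa [Units.smul_mk0, smul_inv_smul₀ hu] at h2

/-- If `R / J` has dimension `μ`, any product of `μ` elements of the maximal ideal lies in `J`:
among its `μ + 1` partial products there is a linear relation modulo `J`, and the first product
that occurs in it divides the relation, with a unit as quotient. -/
theorem prod_mem_of_rank_quotient_eq {J : Ideal (ConvergentSeries n)} {μ : ℕ}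
    (hJ : Module.rank ℂ (ConvergentSeries n ⧸ J) = μ) {y : ℕ → ConvergentSeries n}
    (hy : ∀ k, constantCoeff (y k).1 = 0) : ∏ k ∈ range μ, y k ∈ J := by
  classical
  have hdep : ¬ LinearIndependent ℂ
      (fun j : Fin (μ + 1) => Ideal.Quotient.mkₐ ℂ J (∏ k ∈ range (j : ℕ), y k)) := by
    intro h
    have := h.cardinal_le_rank
    rw [hJ, Cardinal.mk_fin] at this
    exact absurd (Nat.cast_le.1 this) (by omega)
  obtain ⟨c, hc, hne⟩ := Fintype.not_linearIndependent_iff.1 hdep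
  have hmem : ∑ j, c j • ∏ k ∈ range (j : ℕ), y k ∈ J := by
    rw [← Ideal.Quotient.eq_zero_iff_mem, ← Ideal.Quotient.mkₐ_eq_mk ℂ, map_sum]
    simpa only [map_smul] using hc
  obtain ⟨m, hm, hmin⟩ := WellFounded.has_min (wellFounded_lt (α := Fin (μ + 1)))
    {j | c j ≠ 0} hne
  let w : Fin (μ + 1) → ConvergentSeries n := fun j =>
    if j < m then 0 else c j • ∏ k ∈ Ico (m : ℕ) j, y k
  have hfac : ∑ j, c j • ∏ k ∈ range (j : ℕ), y k = (∏ k ∈ range (m : ℕ), y k) * ∑ j, w j := by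
    rw [mul_sum]
    refine sum_congr rfl fun j _ => ?_
    by_cases hj : j < m
    · have : c j = 0 := by
        by_contra h
        exact hmin j h hj
      simp [w, hj, this]
    · simp only [w, hj, if_false]
      rw [mul_smul_comm, prod_range_mul_prod_Ico _ (by simpa using hj)]
  have hunit : IsUnit (∑ j, w j) := by
    refine isUnit_of_constantCoeff_ne_zero ?_
    have hcc : constantCoeff (∑ j, w j).1 = ∑ j, constantCoeff (w j).1 :=
      map_sum ((constantCoeff (σ := Fin n) (R := ℂ)).comp (ConvergentSeries n).val.toRingHom) w univ
    rw [hcc, sum_eq_single m]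
    · have : w m = c m • 1 := by simp [w]
      rw [this]
      change constantCoeff (c m • (1 : MvPowerSeries (Fin n) ℂ)) ≠ 0
      simpa using hm
    · intro j _ hj
      by_cases hlt : j < m
      · simp [w, hlt]
      · have hmj : (m : ℕ) < j := lt_of_le_of_ne (by simpa using hlt) fun h => hj (Fin.ext h.symm)
        simp only [w, hlt, if_false]
        rw [prod_eq_prod_Ico_succ_bot hmj]
        change constantCoeff (c j • ((y m).1 * _)) = 0
        rw [constantCoeff_smul, map_mul, hy, zero_mul, smul_zero]
    · simp
  have hpm : ∏ k ∈ range (m : ℕ), y k ∈ J := by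
    rw [hfac] at hmem
    exact (Ideal.mul_unit_mem_iff_mem J hunit).1 hmem
  rw [← prod_range_mul_prod_Ico y (Nat.lt_succ_iff.1 m.2)]
  exact J.mul_mem_right _ hpm

theorem isConvergent_monomial (d : Fin n →₀ ℕ) (c : ℂ) :
    (monomial d c : MvPowerSeries (Fin n) ℂ).IsConvergent := by
  classical
  refine ⟨1, one_pos, summable_of_ne_finset_zero (s := {d}) fun e he => ?_⟩
  rw [coeff_monomial, if_neg (by simpa using he)]
  simp

theorem exists_prod_eq_monomial (k : ℕ) (d : Fin n →₀ ℕ) (hd : d.degree = k) :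
    ∃ y : ℕ → ConvergentSeries n, (∀ j, constantCoeff (y j).1 = 0) ∧
      (∏ j ∈ range k, y j : ConvergentSeries n).1 = monomial d 1 := by
  classical
  induction k generalizing d with
  | zero =>
    rw [Finsupp.degree_eq_zero_iff] at hd
    subst hd
    exact ⟨fun _ => 0, fun _ => map_zero _, rfl⟩
  | succ k ih =>
    obtain ⟨i, hi⟩ : ∃ i, d i ≠ 0 := by
      by_contra! h
      rw [show d = 0 from Finsupp.ext h, map_zero] at hd
      omega
    have hle : Finsupp.single i 1 ≤ d := by
      rw [Finsupp.single_le_iff]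
      omega
    have hsplit : d - Finsupp.single i 1 + Finsupp.single i 1 = d := tsub_add_cancel_of_le hle
    obtain ⟨y, hy, hprod⟩ := ih (d - Finsupp.single i 1) (by
      have := congrArg Finsupp.degree hsplit
      rw [map_add, Finsupp.degree_single] at this
      omega)
    refine ⟨fun j => if j = k then ⟨_, isConvergent_monomial (Finsupp.single i 1) 1⟩ else y j,
      fun j => ?_, ?_⟩
    · dsimp only
      split_ifs
      · rw [← coeff_zero_eq_constantCoeff_apply, coeff_monomial, if_neg]
        simp [eq_comm]
      · exact hy j
    · rw [prod_range_succ, if_pos rfl,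
        prod_congr rfl fun j hj => if_neg (mem_range.1 hj).ne, ← hsplit]
      change (∏ j ∈ range k, y j : ConvergentSeries n).1 * monomial (Finsupp.single i 1) 1 = _
      rw [hprod, monomial_mul_monomial, mul_one]

/-- If `f` has Milnor number `μ`, then all monomials of degree `μ` lie in the Jacobian ideal. -/
theorem exists_vectorField_eq_monomial {f : ConvergentSeries n} {μ : ℕ}
    (hμ : milnorNumber f = (μ : ℕ∞)) {d : Fin n →₀ ℕ} (hd : d.degree = μ) :
    ∃ b : Fin n → MvPowerSeries (Fin n) ℂ, (∀ i, (b i).IsConvergent) ∧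
      vectorField b f.1 = monomial d 1 := by
  obtain ⟨y, hy, hprod⟩ := exists_prod_eq_monomial μ d hd
  have hmem := prod_mem_of_rank_quotient_eq (Cardinal.toENat_eq_natCast.1 hμ) hy
  obtain ⟨c, hc⟩ := Ideal.mem_span_range_iff_exists_fun.1 hmem
  refine ⟨fun i => (c i).1, fun i => (c i).2, ?_⟩
  rw [vectorField_apply, ← hprod, ← hc]
  exact (map_sum (ConvergentSeries n).val (fun i => c i * pderiv i f) univ).symm

end ConvergentSeries

namespace MvPowerSeries

variable {n : ℕ}

/-! ### Division by monomials -/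

/-- The quotient of `F` by the monomial of exponent `α`, where only the terms of `F` whose exponent
`d` is assigned to `α` by `τ` are divided. -/
noncomputable def monomialQuotient (τ : (Fin n →₀ ℕ) → (Fin n →₀ ℕ)) (α : Fin n →₀ ℕ)
    (F : MvPowerSeries (Fin n) ℂ) : MvPowerSeries (Fin n) ℂ :=
  fun e => if τ (e + α) = α then coeff (e + α) F else 0

theorem coeff_monomialQuotient (τ : (Fin n →₀ ℕ) → (Fin n →₀ ℕ))
    (α : Fin n →₀ ℕ) (F : MvPowerSeries (Fin n) ℂ) (e : Fin n →₀ ℕ) :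
    coeff e (monomialQuotient τ α F) = if τ (e + α) = α then coeff (e + α) F else 0 :=
  rfl

/-- Sorting the terms of a series of order at least `μ` by a chosen monomial of degree `μ` that
divides them writes the series as a combination of the monomials of degree `μ`. -/
theorem sum_monomial_mul_monomialQuotient {τ : (Fin n →₀ ℕ) → (Fin n →₀ ℕ)} {μ : ℕ}
    (hτ : ∀ d, μ ≤ d.degree → τ d ≤ d ∧ (τ d).degree = μ) {F : MvPowerSeries (Fin n) ℂ}
    (hF : μ ≤ F.order) :
    ∑ α ∈ (Finsupp.finite_of_degree_eq μ).toFinset, monomial α 1 * monomialQuotient τ α F = F := by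
  classical
  ext d
  rw [map_sum]
  simp_rw [coeff_monomial_mul, coeff_monomialQuotient, one_mul]
  rcases lt_or_ge d.degree μ with hd | hd
  · rw [coeff_of_lt_order (lt_of_lt_of_le (by exact_mod_cast hd) hF)]
    refine sum_eq_zero fun α hα => if_neg fun hle => ?_
    have hα' : α.degree = μ := by simpa using hα
    exact absurd (Finsupp.degree_mono hle) (by omega)
  · rw [sum_eq_single (τ d)]
    · rw [if_pos (hτ d hd).1, tsub_add_cancel_of_le (hτ d hd).1, if_pos rfl]
    · intro α _ hne
      split_ifs with h1 h2
      · rw [tsub_add_cancel_of_le h1] at h2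
        exact absurd h2.symm hne
      · rfl
      · rfl
    · intro h
      exact absurd (hτ d hd).2 (by simpa using h)

theorem le_order_monomialQuotient (τ : (Fin n →₀ ℕ) → (Fin n →₀ ℕ)) {α : Fin n →₀ ℕ}
    {F : MvPowerSeries (Fin n) ℂ} {p : ℕ} (hF : ((α.degree + p : ℕ) : ℕ∞) ≤ F.order) :
    p ≤ (monomialQuotient τ α F).order := by
  classical
  refine le_order fun d hd => ?_
  rw [coeff_monomialQuotient, coeff_of_lt_order (lt_of_lt_of_le ?_ hF), ite_self]
  rw [map_add, add_comm]
  exact_mod_cast Nat.add_lt_add_left (by exact_mod_cast hd) _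

theorem pow_mul_polydiscNorm_monomialQuotient_le (τ : (Fin n →₀ ℕ) → (Fin n →₀ ℕ))
    (α : Fin n →₀ ℕ) (F : MvPowerSeries (Fin n) ℂ) (r : ℝ≥0) :
    (r : ℝ≥0∞) ^ α.degree * polydiscNorm r (monomialQuotient τ α F) ≤ polydiscNorm r F := by
  classical
  rw [polydiscNorm, ← ENNReal.tsum_mul_left]
  refine le_trans ?_ (ENNReal.tsum_comp_le_tsum_of_injective (add_left_injective α) _)
  refine ENNReal.tsum_le_tsum fun d => ?_
  rw [coeff_monomialQuotient, map_add, pow_add]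
  split_ifs
  · exact le_of_eq (by ring)
  · simp

end MvPowerSeries

namespace ConvergentSeries

open MvPowerSeries

variable {n : ℕ}

/-! ### Solving for vector fields -/

/-- Division by the partial derivatives of `f`, with bounds: `h` of order at least `μ + p` is
the derivative of `f` along a vector field with coefficients of order at least `p`, and the
norms of the coefficients are controlled by the norm of `h` on every small polydisc. -/
theorem exists_vectorField_eq {f : ConvergentSeries n} {μ : ℕ}
    (hμ : milnorNumber f = (μ : ℕ∞)) :
    ∃ K : ℝ≥0, ∀ᶠ r : ℝ≥0 in nhdsWithin (0 : ℝ≥0) (Set.Ioi 0), ∀ (p : ℕ) (h : MvPowerSeries (Fin n) ℂ),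
      ((μ + p : ℕ) : ℕ∞) ≤ h.order → ∃ a : Fin n → MvPowerSeries (Fin n) ℂ,
        vectorField a f.1 = h ∧ (∀ i, p ≤ (a i).order) ∧
        ∀ i, (r : ℝ≥0∞) ^ μ * polydiscNorm r (a i) ≤ K * polydiscNorm r h := by
  classical
  have hfin := Finsupp.finite_of_degree_eq (σ := Fin n) μ
  have hT : ∀ α ∈ hfin.toFinset, α.degree = μ := fun α hα => by simpa using hα
  choose! b hbc hb using fun (d : Fin n →₀ ℕ) (hd : d.degree = μ) =>
    exists_vectorField_eq_monomial hμ hd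
  choose! τ hτ using fun (d : Fin n →₀ ℕ) (hd : μ ≤ d.degree) => Finsupp.exists_le_degree_eq d μ hd
  have hev : ∀ᶠ r : ℝ≥0 in nhdsWithin (0 : ℝ≥0) (Set.Ioi 0), ∀ α ∈ hfin.toFinset, ∀ i,
      polydiscNorm r (b α i) ≠ ∞ :=
    (Filter.eventually_all_finset _).2 fun α hα => Filter.eventually_all.2 fun i =>
      (hbc α (hT α hα) i).eventually_polydiscNorm_ne_top
  obtain ⟨R, hR, hR0⟩ := (hev.and self_mem_nhdsWithin).exists
  obtain ⟨K, hK⟩ : ∃ K : ℝ≥0, (K : ℝ≥0∞) = ∑ α ∈ hfin.toFinset, ∑ i, polydiscNorm R (b α i) :=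
    ⟨_, ENNReal.coe_toNNReal (ENNReal.sum_ne_top.2 fun α hα =>
      ENNReal.sum_ne_top.2 fun i _ => hR α hα i)⟩
  refine ⟨K, ?_⟩
  filter_upwards [Ioo_mem_nhdsGT hR0] with r hr p h hh
  refine ⟨fun i => ∑ α ∈ hfin.toFinset, b α i * monomialQuotient τ α h, ?_, fun i => ?_,
    fun i => ?_⟩
  · have hμh : (μ : ℕ∞) ≤ h.order := le_trans (by norm_cast; omega) hh
    rw [vectorField_apply]
    simp_rw [sum_mul]
    rw [sum_comm]
    refine Eq.trans (sum_congr rfl fun α hα => ?_) (sum_monomial_mul_monomialQuotient hτ hμh)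
    rw [← hb α (hT α hα), vectorField_apply, sum_mul]
    exact sum_congr rfl fun i _ => by ring
  · refine le_order_sum fun α hα => le_trans ?_ le_order_mul
    exact (le_order_monomialQuotient τ (by rwa [hT α hα])).trans le_add_self
  · calc (r : ℝ≥0∞) ^ μ * polydiscNorm r (∑ α ∈ hfin.toFinset, b α i * monomialQuotient τ α h)
        ≤ (r : ℝ≥0∞) ^ μ * ∑ α ∈ hfin.toFinset,
            polydiscNorm r (b α i) * polydiscNorm r (monomialQuotient τ α h) := by
          gcongr
          exact (polydiscNorm_sum_le _ _ _).trans (sum_le_sum fun α _ => polydiscNorm_mul_le _ _ _)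
      _ = ∑ α ∈ hfin.toFinset, polydiscNorm r (b α i) *
            ((r : ℝ≥0∞) ^ μ * polydiscNorm r (monomialQuotient τ α h)) := by
          rw [mul_sum]
          exact sum_congr rfl fun α _ => by ring
      _ ≤ ∑ α ∈ hfin.toFinset, (∑ i, polydiscNorm R (b α i)) * polydiscNorm r h := by
          refine sum_le_sum fun α hα => mul_le_mul' ?_ ?_
          · exact (polydiscNorm_mono hr.2.le _).trans
              (single_le_sum (f := fun i => polydiscNorm R (b α i)) (fun _ _ => zero_le)
                (mem_univ i))
          · have := pow_mul_polydiscNorm_monomialQuotient_le τ α h r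
            rwa [hT α hα] at this
      _ = K * polydiscNorm r h := by rw [hK, sum_mul]

theorem le_order_of_mem_maximalIdeal_pow {g : ConvergentSeries n} {k : ℕ}
    (hg : g ∈ maximalIdeal n ^ k) : k ≤ g.1.order := by
  induction k generalizing g with
  | zero => simp
  | succ k ih =>
    rw [pow_succ] at hg
    refine Submodule.mul_induction_on hg (fun x hx y hy => ?_) fun x y hx hy => le_order_add hx hy
    refine le_trans ?_ le_order_mul
    push_cast
    exact add_le_add (ih hx) (one_le_order_iff_constCoeff_eq_zero.2 hy)

/-- For `f` of Milnor number `μ` and `g` of order at least `μ + 2`, there is a time-dependent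
vector field `ξ` with `ξ (f + t g) = - g`. Dividing by the partial derivatives of `f` gives
`L h` with `(L h) f = h`; then `ξ = L h` solves the equation if `h + t (L h) g = - g`. As
`h ↦ (L h) g` has small norm on small polydiscs, the Neumann series for `h` converges. -/
theorem exists_time_dependent_vectorField {f : ConvergentSeries n} {μ : ℕ}
    (hμ : milnorNumber f = (μ : ℕ∞)) {g : ConvergentSeries n}
    (hg : ((μ + 2 : ℕ) : ℕ∞) ≤ g.1.order) :
    ∃ (a : ℕ → Fin n → MvPowerSeries (Fin n) ℂ) (r M : ℝ≥0), 0 < r ∧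
      (∀ j i, ((j + 2 : ℕ) : ℕ∞) ≤ (a j i).order) ∧
      (∀ j i, polydiscNorm r (a j i) ≤ M * 8⁻¹ ^ j) ∧
      vectorField (a 0) f.1 = -g.1 ∧
      ∀ j, vectorField (a (j + 1)) f.1 = -vectorField (a j) g.1 := by
  obtain ⟨K, hK⟩ := exists_vectorField_eq hμ
  -- As `∂ᵢ g` has order at least `μ + 1`, its norm is `o(r ^ μ)`. The factor `8` yields the ratio of
  -- the Neumann series; `n + 1` absorbs the sum over `i` and is nonzero also for `n = 0`.
  have hsmall : ∀ᶠ r : ℝ≥0 in nhdsWithin (0 : ℝ≥0) (Set.Ioi 0), ∀ i,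
      ((8 * (n + 1) * K : ℝ≥0) : ℝ≥0∞) * polydiscNorm r (MvPowerSeries.pderiv ℂ i g.1)
        ≤ (r : ℝ≥0∞) ^ μ :=
    Filter.eventually_all.2 fun i => (IsConvergent.pderiv g.2 i).eventually_mul_polydiscNorm_le
      (le_order_pderiv hg i) _
  obtain ⟨r, ⟨⟨hdiv, hsm⟩, hgr⟩, hr0⟩ :=
    (((hK.and hsmall).and g.2.eventually_polydiscNorm_ne_top).and self_mem_nhdsWithin).exists
  choose! A hAf hAo hAn using hdiv
  let H : ℕ → MvPowerSeries (Fin n) ℂ := fun j =>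
    Nat.rec (-g.1) (fun j h => -vectorField (A (j + 2) h) g.1) j
  have hH : ∀ j, H (j + 1) = -vectorField (A (j + 2) (H j)) g.1 := fun _ => rfl
  have hHo : ∀ j : ℕ, ((μ + (j + 2) : ℕ) : ℕ∞) ≤ (H j).order := by
    intro j
    induction j with
    | zero =>
      change _ ≤ (-g.1).order
      rwa [order_neg]
    | succ j ih =>
      have h := raisesOrder_vectorField (j := j + 1) (hAo _ _ ih) _ _ hg
      rw [hH, order_neg]
      refine le_trans ?_ h
      norm_cast
      omega
  have hr : (r : ℝ≥0∞) ^ μ ≠ 0 := pow_ne_zero _ (by exact_mod_cast (ne_of_gt hr0))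
  have hrt : (r : ℝ≥0∞) ^ μ ≠ ∞ := ENNReal.pow_ne_top ENNReal.coe_ne_top
  have hstep : ∀ j, 8 * polydiscNorm r (H (j + 1)) ≤ polydiscNorm r (H j) := by
    intro j
    have hn0 : ((n : ℝ≥0∞) + 1) * (r : ℝ≥0∞) ^ μ ≠ 0 := mul_ne_zero (by positivity) hr
    refine (ENNReal.mul_le_mul_iff_right hn0 (ENNReal.mul_ne_top (by finiteness) hrt)).1 ?_
    calc ((n : ℝ≥0∞) + 1) * (r : ℝ≥0∞) ^ μ * (8 * polydiscNorm r (H (j + 1)))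
        ≤ ((n : ℝ≥0∞) + 1) * (r : ℝ≥0∞) ^ μ * (8 * ∑ i, polydiscNorm r (A (j + 2) (H j) i) *
            polydiscNorm r (MvPowerSeries.pderiv ℂ i g.1)) := by
          rw [hH, polydiscNorm_neg, vectorField_apply]
          gcongr
          exact (polydiscNorm_sum_le _ _ _).trans (sum_le_sum fun i _ => polydiscNorm_mul_le _ _ _)
      _ = ∑ i, (r : ℝ≥0∞) ^ μ * polydiscNorm r (A (j + 2) (H j) i) *
            (8 * ((n : ℝ≥0∞) + 1) * polydiscNorm r (MvPowerSeries.pderiv ℂ i g.1)) := by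
          rw [mul_sum, mul_sum]
          exact sum_congr rfl fun i _ => by ring
      _ ≤ ∑ i, K * polydiscNorm r (H j) *
            (8 * ((n : ℝ≥0∞) + 1) * polydiscNorm r (MvPowerSeries.pderiv ℂ i g.1)) :=
          sum_le_sum fun i _ => mul_le_mul' (hAn _ _ (hHo j) i) le_rfl
      _ = ∑ i, polydiscNorm r (H j) * (((8 * (n + 1) * K : ℝ≥0) : ℝ≥0∞) *
            polydiscNorm r (MvPowerSeries.pderiv ℂ i g.1)) := by
          refine sum_congr rfl fun i _ => ?_
          push_cast
          ring
      _ ≤ ∑ _i : Fin n, polydiscNorm r (H j) * (r : ℝ≥0∞) ^ μ :=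
          sum_le_sum fun i _ => mul_le_mul' le_rfl (hsm i)
      _ = n * (polydiscNorm r (H j) * (r : ℝ≥0∞) ^ μ) := by
          rw [sum_const, card_univ, Fintype.card_fin, nsmul_eq_mul]
      _ ≤ ((n : ℝ≥0∞) + 1) * (polydiscNorm r (H j) * (r : ℝ≥0∞) ^ μ) := by
          gcongr
          exact le_self_add
      _ = _ := by ring
  have hgeom : ∀ j, polydiscNorm r (H j) ≤ polydiscNorm r g.1 * 8⁻¹ ^ j := by
    intro j
    induction j with
    | zero =>
      change polydiscNorm r (-g.1) ≤ _
      simp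
    | succ j ih =>
      have h := (ENNReal.mul_le_iff_le_inv (by norm_num) (by norm_num)).1 (hstep j)
      rw [pow_succ', mul_left_comm]
      exact h.trans (by gcongr)
  have hMt : (K : ℝ≥0∞) * polydiscNorm r g.1 / (r : ℝ≥0∞) ^ μ ≠ ∞ :=
    ENNReal.div_ne_top (ENNReal.mul_ne_top ENNReal.coe_ne_top hgr) hr
  refine ⟨fun j => A (j + 2) (H j), r, (K * polydiscNorm r g.1 / (r : ℝ≥0∞) ^ μ).toNNReal, hr0,
    fun j => hAo _ _ (hHo j), fun j i => ?_, hAf _ _ (hHo 0), fun j => hAf _ _ (hHo (j + 1))⟩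
  rw [ENNReal.coe_toNNReal hMt, div_eq_mul_inv, mul_right_comm, ← div_eq_mul_inv,
    ENNReal.le_div_iff_mul_le (Or.inl hr) (Or.inl hrt), mul_comm]
  refine (hAn _ _ (hHo j) i).trans ?_
  rw [mul_assoc]
  gcongr
  exact hgeom j

end ConvergentSeries

theorem mainTheorem6 (n : ℕ) (f : ConvergentSeries n) (μ : ℕ)
    (hμ : ConvergentSeries.milnorNumber f = (μ : ℕ∞))
    (g : ConvergentSeries n) (hg : g ∈ ConvergentSeries.maximalIdeal n ^ (μ + 2)) :
    ∃ φ : ConvergentSeries n ≃ₐ[ℂ] ConvergentSeries n, φ (f + g) = f := by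
  obtain ⟨a, r, M, hr, hord, hM, h0, hs⟩ :=
    ConvergentSeries.exists_time_dependent_vectorField hμ
      (ConvergentSeries.le_order_of_mem_maximalIdeal_pow hg)
  exact MvPowerSeries.exists_algEquiv_of_vectorField a hord hr hM h0 hs
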